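/- Let $(X,Y)$ be a pair of real random variables with $E[X^8]<\infty$, $E[Y^8]<\infty$, neither of them almost surely constant. Write $\breve X=(X-E[X])/\mathrm{sd}(X)$, $\breve Y=(Y-E[Y])/\mathrm{sd}(Y)$, and assume that $\breve X^2$ and $\breve Y^2$ are not almost surely constant either. Let $\rho_1=\mathrm{corr}(X,Y)$ and $\rho_2=\mathrm{corr}(\breve X^2,\breve Y^2)$ be Pearson correlations. Let $(X_1,Y_1),(X_2,Y_2),\dots$ be i.i.d. copies of $(X,Y)$. Let $\hat\rho_1$ be the sample correlation of $(X_1,Y_1),\dots,(X_n,Y_n)$, and let $\hat\rho_2$ be the sample correlation of the squares of the empirically standardized observations $(X_i-\bar X_n)/s_x$, $(Y_i-\bar Y_n)/s_y$, where $\bar X_n,\bar Y_n$ are the sample means and $s_x^2=\frac1n\sum_{i\le n}(X_i-\bar X_n)^2$, $s_y^2=\frac1n\sum_{i\le n}(Y_i-\bar Y_n)^2$ (quotients with denominator $0$ are set to $0$). Let $e_{kl}=E[\breve X^k\breve Y^l]$ and $c_{kl,sr}=\mathrm{Cov}(\breve X^k\breve Y^l,\breve X^s\breve Y^r)$, and let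 $\Sigma_m=(c_{kl,sr})$ be the $12\times12$ matrix with $kl$ and $sr$ ranging, in this order, through $10,01,20,02,11,30,03,21,12,40,04,22$. Let $M=BA$ with $$A=\begin{pmatrix} 0&0&1&0&0&0&0&0&0&0&0&0\\ 0&0&0&1&0&0&0&0&0&0&0&0\\ 0&0&0&0&1&0&0&0&0&0&0&0\\ -4e_{30}&0&-2e_{40}&0&0&0&0&0&0&1&0&0\\ 0&-4e_{03}&0&-2e_{04}&0&0&0&0&0&0&1&0\\ -2e_{12}&-2e_{21}&-e_{22}&-e_{22}&0&0&0&0&0&0&0&1 \end{pmatrix},$$ $$B=\begin{pmatrix} -\frac{\rho_1}2&-\frac{\rho_1}2&1&0&0&0\\ 0&0&0&-\frac{\rho_2}{2(e_{40}-1)}&-\frac{\rho_2}{2(e_{04}-1)}&\frac1{\sqrt{(e_{40}-1)(e_{04}-1)}} \end{pmatrix},$$ and let $\Sigma^*=M\Sigma_mM^\top$. Then $\Sigma^*$ is positive semidefinite and, as $n\to\infty$, $$\sqrt n\,\big((\hat\rho_1,\hat\rho_2)-(\rho_1,\rho_2)\big)\to\mathcal N_2(0,\Sigma^*)\quad\text{in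 distribution.}$$ Moreover: (a) $\Sigma^*_{1,1}=\frac{\rho_1^2}{4}(e_{40}+e_{04}+2e_{22})-\rho_1(e_{31}+e_{13})+e_{22}$. (b) If $X$ and $Y$ are independent, then $$\Sigma^*=\begin{pmatrix}1&\tau\\ \tau&1\end{pmatrix},\qquad \tau=\frac{E[\breve X^3]\,E[\breve Y^3]}{\sqrt{(E[\breve X^4]-1)(E[\breve Y^4]-1)}}.$$ Hence $\Sigma^*$ is the identity matrix if $E[\breve X^3]=0$ or $E[\breve Y^3]=0$, in particular if the distribution of $X$ or that of $Y$ is symmetric about some point. (c) If $(X,Y)$ is bivariate normal (possibly degenerate), then with $\rho=\rho_1$ $$\Sigma^*=\begin{pmatrix}(1-\rho^2)^2&2\rho(1-\rho^2)^2\\ 2\rho(1-\rho^2)^2&(1-\rho^2)^2(3\rho^4+10\rho^2+1)\end{pmatrix}.$$ -/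

import Mathlib

open MeasureTheory ProbabilityTheory Filter

noncomputable section

namespace MomentCorr

section Population

variable {Ω : Type*} [MeasurableSpace Ω]

/-- The standardized variable `(X - E[X]) / sd(X)`. -/
def standardize (μ : Measure Ω) (X : Ω → ℝ) : Ω → ℝ :=
  fun ω => (X ω - ∫ ω', X ω' ∂μ) / Real.sqrt (variance X μ)

/-- Pearson correlation `Cov(X, Y) / (sd(X) sd(Y))`. -/
def pearson (μ : Measure Ω) (X Y : Ω → ℝ) : ℝ :=
  covariance X Y μ / (Real.sqrt (variance X μ) * Real.sqrt (variance Y μ))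

/-- `ρ₁`, the Pearson correlation of `X` and `Y`. -/
def rho1 (μ : Measure Ω) (X Y : Ω → ℝ) : ℝ := pearson μ X Y

/-- `ρ₂`, the Pearson correlation of the squares of the standardized variables. -/
def rho2 (μ : Measure Ω) (X Y : Ω → ℝ) : ℝ :=
  pearson μ (fun ω => standardize μ X ω ^ 2) (fun ω => standardize μ Y ω ^ 2)

/-- The monomial in the standardized variables with exponents `p = (k, l)`. -/
def stdMonomial (μ : Measure Ω) (X Y : Ω → ℝ) (p : ℕ × ℕ) : Ω → ℝ :=
  fun ω => standardize μ X ω ^ p.1 * standardize μ Y ω ^ p.2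

/-- The standardized moment `e_{kl}`. -/
def stdMoment (μ : Measure Ω) (X Y : Ω → ℝ) (k l : ℕ) : ℝ :=
  ∫ ω, stdMonomial μ X Y (k, l) ω ∂μ

/-- The exponent pairs of the twelve moments, in order. -/
def exponents : Fin 12 → ℕ × ℕ :=
  ![(1, 0), (0, 1), (2, 0), (0, 2), (1, 1), (3, 0), (0, 3), (2, 1), (1, 2), (4, 0), (0, 4), (2, 2)]

/-- The covariance matrix `Σ_m` of the twelve monomials in the standardized variables. -/
def SigmaM (μ : Measure Ω) (X Y : Ω → ℝ) : Matrix (Fin 12) (Fin 12) ℝ :=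
  Matrix.of fun i j =>
    covariance (stdMonomial μ X Y (exponents i)) (stdMonomial μ X Y (exponents j)) μ

/-- The matrix `A`. -/
def matA (μ : Measure Ω) (X Y : Ω → ℝ) : Matrix (Fin 6) (Fin 12) ℝ :=
  let e := stdMoment μ X Y
  !![0, 0, 1, 0, 0, 0, 0, 0, 0, 0, 0, 0;
     0, 0, 0, 1, 0, 0, 0, 0, 0, 0, 0, 0;
     0, 0, 0, 0, 1, 0, 0, 0, 0, 0, 0, 0;
     -4 * e 3 0, 0, -2 * e 4 0, 0, 0, 0, 0, 0, 0, 1, 0, 0;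
     0, -4 * e 0 3, 0, -2 * e 0 4, 0, 0, 0, 0, 0, 0, 1, 0;
     -2 * e 1 2, -2 * e 2 1, -e 2 2, -e 2 2, 0, 0, 0, 0, 0, 0, 0, 1]

/-- The matrix `B`. -/
def matB (μ : Measure Ω) (X Y : Ω → ℝ) : Matrix (Fin 2) (Fin 6) ℝ :=
  let e := stdMoment μ X Y
  let r1 := rho1 μ X Y
  let r2 := rho2 μ X Y
  !![-r1 / 2, -r1 / 2, 1, 0, 0, 0;
     0, 0, 0, -(r2 / (2 * (e 4 0 - 1))), -(r2 / (2 * (e 0 4 - 1))),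
       1 / Real.sqrt ((e 4 0 - 1) * (e 0 4 - 1))]

/-- The matrix `M = B A`. -/
def matM (μ : Measure Ω) (X Y : Ω → ℝ) : Matrix (Fin 2) (Fin 12) ℝ :=
  matB μ X Y * matA μ X Y

/-- The asymptotic covariance matrix `Σ* = M Σ_m Mᵀ`. -/
def SigmaStar (μ : Measure Ω) (X Y : Ω → ℝ) : Matrix (Fin 2) (Fin 2) ℝ :=
  matM μ X Y * SigmaM μ X Y * (matM μ X Y).transpose

/-- `X` is almost surely equal to a constant. -/
def AEConst (μ : Measure Ω) (X : Ω → ℝ) : Prop :=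
  ∃ c : ℝ, ∀ᵐ ω ∂μ, X ω = c

/-- The distribution of `X` is symmetric about some point `a`. -/
def IsSymmetric (μ : Measure Ω) (X : Ω → ℝ) : Prop :=
  ∃ a : ℝ, IdentDistrib (fun ω => X ω - a) (fun ω => a - X ω) μ μ

end Population

section Sample

/-- Empirical mean of `x 0, …, x (n - 1)`. -/
def sampleMean (n : ℕ) (x : ℕ → ℝ) : ℝ := (∑ i ∈ Finset.range n, x i) / n

/-- Empirical covariance (normalized by `n`). -/
def sampleCov (n : ℕ) (x y : ℕ → ℝ) : ℝ :=
  (∑ i ∈ Finset.range n, (x i - sampleMean n x) * (y i - sampleMean n y)) / n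

/-- Empirical standard deviation. -/
def sampleSd (n : ℕ) (x : ℕ → ℝ) : ℝ := Real.sqrt (sampleCov n x x)

/-- Empirical Pearson correlation. -/
def sampleCorr (n : ℕ) (x y : ℕ → ℝ) : ℝ :=
  sampleCov n x y / (sampleSd n x * sampleSd n y)

/-- Empirically standardized observations. -/
def sampleStandardize (n : ℕ) (x : ℕ → ℝ) : ℕ → ℝ :=
  fun i => (x i - sampleMean n x) / sampleSd n x

/-- The estimator of `ρ₁`: the sample correlation. -/
def rho1Hat (n : ℕ) (x y : ℕ → ℝ) : ℝ := sampleCorr n x y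

/-- The estimator of `ρ₂`: the sample correlation of the squares of the empirically
standardized observations. -/
def rho2Hat (n : ℕ) (x y : ℕ → ℝ) : ℝ :=
  sampleCorr n (fun i => sampleStandardize n x i ^ 2) (fun i => sampleStandardize n y i ^ 2)

end Sample

end MomentCorr

end

open MomentCorr

/-! Sample correlations do not change under increasing affine maps of either coordinate, so the data
may be standardized with the unknown population means and standard deviations. Both estimators are
then a fixed map `corrMap` of the vector of twelve empirical raw moments (`corrMap_sampleMoments`),
an exact identity even when a denominator vanishes.

That vector averages i.i.d. vectors whose entries are monomials of degree at most four, square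
integrable because eighth moments are finite. The strong law and `multivariate_clt` give its
convergence to the population moments and its Gaussian fluctuations with covariance `SigmaM`. There
the variances are 1 and `e 4 0 - 1`, `e 0 4 - 1` are positive, so `corrMap` is differentiable, with
differential `matM`. The delta method gives the linear image of the Gaussian vector, of covariance
`SigmaStar`.

The explicit entries are covariances of two linear forms in the monomials. Under independence all
moments factor. In the normal case `Y` is split into its regression on `X` and an independent
Gaussian residual, which gives every mixed moment as a polynomial in `ρ`. -/

namespace MomentCorr

/-! ### Multivariate central limit theorem and delta method -/

section Limit

open scoped Topology RealInnerProductSpace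

variable {Ω Ω' : Type*} [MeasurableSpace Ω] [MeasurableSpace Ω']
  {μ : Measure Ω} {P : Measure Ω'} {ι : Type*} [Fintype ι]

/-- The covariance matrix of a random vector. -/
noncomputable def covMatrix (μ : Measure Ω) (Z : Ω → EuclideanSpace ℝ ι) : Matrix ι ι ℝ :=
  Matrix.of fun i j => covariance (fun ω => Z ω i) (fun ω => Z ω j) μ

lemma memLp_coord {Z : Ω → EuclideanSpace ℝ ι} (hZ : MemLp Z 2 μ) (i : ι) :
    MemLp (fun ω => Z ω i) 2 μ := by
  exact (EuclideanSpace.proj (𝕜 := ℝ) i).comp_memLp' hZ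

lemma charFun_eq_charFun_inner {Z : Ω → EuclideanSpace ℝ ι} (hZ : AEMeasurable Z μ)
    (t : EuclideanSpace ℝ ι) :
    charFun (μ.map Z) t = charFun (μ.map fun ω => ⟪Z ω, t⟫) 1 := by
  rw [charFun_apply, charFun_apply, integral_map hZ (by fun_prop),
    integral_map (by fun_prop) (by fun_prop)]
  simp

variable [IsProbabilityMeasure μ]

lemma variance_inner_eq {Z : Ω → EuclideanSpace ℝ ι} (hZ : MemLp Z 2 μ)
    (t : EuclideanSpace ℝ ι) :
    variance (fun ω => ⟪Z ω, t⟫) μ = t.ofLp ⬝ᵥ (covMatrix μ Z).mulVec t.ofLp := by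
  have h : (fun ω => ⟪Z ω, t⟫) = fun ω => ∑ i, t i * Z ω i := by
    ext ω
    simp [PiLp.inner_apply]
  have hm : ∀ i, MemLp (fun ω => t i * Z ω i) 2 μ := fun i => (memLp_coord hZ i).const_mul _
  rw [h, ← covariance_self (memLp_finsetSum _ fun i _ => hm i).aestronglyMeasurable.aemeasurable,
    covariance_fun_sum_fun_sum hm hm]
  simp only [covariance_const_mul_left, covariance_const_mul_right, dotProduct, Matrix.mulVec,
    Finset.mul_sum, covMatrix, Matrix.of_apply]
  exact Finset.sum_congr rfl fun i _ => Finset.sum_congr rfl fun j _ => by ring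

lemma covMatrix_posSemidef {Z : Ω → EuclideanSpace ℝ ι} (hZ : MemLp Z 2 μ) :
    (covMatrix μ Z).PosSemidef := by
  refine Matrix.PosSemidef.of_dotProduct_mulVec_nonneg ?_ fun x => ?_
  · ext i j
    simp [covMatrix, covariance_comm]
  · have := variance_inner_eq hZ (WithLp.toLp 2 x)
    simp only [star_trivial]
    rw [← this]
    exact variance_nonneg _ _

variable [IsProbabilityMeasure P]

/-- The multivariate central limit theorem. -/
theorem multivariate_clt [DecidableEq ι]
    {Z : ℕ → Ω' → EuclideanSpace ℝ ι} {Z' : Ω → EuclideanSpace ℝ ι}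
    (hZ' : MemLp Z' 2 μ) (hindep : iIndepFun Z P) (hident : ∀ i, IdentDistrib (Z i) Z' P μ) :
    TendstoInDistribution
      (fun (n : ℕ) ω => (Real.sqrt n)⁻¹ • (∑ k ∈ Finset.range n, Z k ω - (n : ℝ) • ∫ ω, Z' ω ∂μ))
      atTop (id : EuclideanSpace ℝ ι → EuclideanSpace ℝ ι) (fun _ => P)
      (multivariateGaussian 0 (covMatrix μ Z')) := by
  have hm : ∀ i, AEMeasurable (Z i) P := fun i => (hident i).aemeasurable_fst
  have hmeas : ∀ n : ℕ, AEMeasurable (fun ω => (Real.sqrt n)⁻¹ •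
      (∑ k ∈ Finset.range n, Z k ω - (n : ℝ) • ∫ ω, Z' ω ∂μ)) P := fun n =>
    ((Finset.aemeasurable_fun_sum _ fun k _ => hm k).sub_const _).fun_const_smul _
  refine ⟨hmeas, by fun_prop, ?_⟩
  -- Cramér–Wold: the characteristic function at `t` is that of the projection `⟪·, t⟫` at 1, so
  -- Lévy continuity reduces the claim to the real central limit theorem.
  refine ProbabilityMeasure.tendsto_iff_tendsto_charFun.2 fun t => ?_
  simp only [ProbabilityMeasure.coe_mk, Measure.map_id]
  have hid : ∀ i, IdentDistrib (fun ω => ⟪Z i ω, t⟫) (fun ω => ⟪Z' ω, t⟫) P μ := fun i =>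
    (hident i).comp (u := fun z => ⟪z, t⟫) (by fun_prop)
  have hL : MemLp (fun ω => ⟪Z' ω, t⟫) 2 μ := hZ'.inner_const t
  have hint : ∫ ω, ⟪Z' ω, t⟫ ∂μ = ⟪∫ ω, Z' ω ∂μ, t⟫ := by
    simp_rw [real_inner_comm]
    exact integral_inner (hZ'.integrable (by norm_num)) t
  have key := tendstoInDistribution_inv_sqrt_mul_sum_sub (P := P)
    (X := fun i ω => ⟪Z i ω, t⟫)
    (Y := id) (P' := gaussianReal 0 (variance (fun ω => ⟪Z 0 ω, t⟫) P).toNNReal)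
    ⟨by fun_prop, by simp⟩
    ((hid 0).memLp_iff.2 hL)
    (hindep.comp (fun _ z => ⟪z, t⟫) (by fun_prop))
    (fun i => (hid i).trans (hid 0).symm)
  have key2 := (ProbabilityMeasure.tendsto_iff_tendsto_charFun.1 key.tendsto) 1
  simp only [ProbabilityMeasure.coe_mk, Measure.map_id] at key2
  rw [charFun_gaussianReal, (hid 0).variance_eq] at key2
  rw [charFun_multivariateGaussian (covMatrix_posSemidef hZ'), ← variance_inner_eq hZ' t]
  convert! key2 using 2 with n
  · rw [charFun_eq_charFun_inner (hmeas n)]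
    congr 2
    ext ω
    simp only [real_inner_smul_left, inner_sub_left, sum_inner]
    rw [(hid 0).integral_eq, hint]
  · simp [Real.coe_toNNReal _ (variance_nonneg _ _)]

/-- The delta method: an almost surely consistent sequence and a map differentiable at its
limit. -/
theorem tendstoInDistribution_delta {E F : Type*}
    [NormedAddCommGroup E] [NormedSpace ℝ E] [MeasurableSpace E] [BorelSpace E]
    [SecondCountableTopology E]
    [NormedAddCommGroup F] [NormedSpace ℝ F] [MeasurableSpace F] [BorelSpace F]
    [SecondCountableTopology F]
    {S : ℕ → Ω' → E} {e : E} {a : ℕ → ℝ} (ha : ∀ n, 0 ≤ a n) {Z : Ω → E}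
    (hS : ∀ n, AEMeasurable (S n) P)
    (hlim : ∀ᵐ ω ∂P, Tendsto (fun n => S n ω) atTop (𝓝 e))
    (hdist : TendstoInDistribution (fun n ω => a n • (S n ω - e)) atTop Z (fun _ => P) μ)
    {G : E → F} {G' : E →L[ℝ] F} (hG : Measurable G) (hG' : HasFDerivAt G G' e) :
    TendstoInDistribution (fun n ω => a n • (G (S n ω) - G e)) atTop (fun ω => G' (Z ω))
      (fun _ => P) μ := by
  -- Normalized Taylor remainder. Since `0⁻¹ = 0`, it vanishes at `e` itself, so it tends to 0 along
  -- the full neighbourhood filter.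
  let r : E → F := fun s => ‖s - e‖⁻¹ • (G s - G e - G' (s - e))
  have hr : Measurable r := by fun_prop
  have hr0 : Tendsto r (𝓝 e) (𝓝 0) := by
    have := hasFDerivAt_iff_tendsto.1 hG'
    rw [tendsto_zero_iff_norm_tendsto_zero]
    simpa [r, norm_smul] using this
  have hrS : TendstoInMeasure P (fun n ω => r (S n ω)) atTop (fun _ => (0 : F)) := by
    refine tendstoInMeasure_of_tendsto_ae
      (fun n => (hr.comp_aemeasurable (hS n)).aestronglyMeasurable) ?_
    filter_upwards [hlim] with ω hω using hr0.comp hω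
  -- Slutsky for `(z, w) ↦ G' z + ‖z‖ • w`: at `z = a n • (S n - e)`, `w = r (S n)` it is exactly `a
  -- n • (G (S n) - G e)`, and at `w = 0` only `G' z` remains.
  have := hdist.continuous_comp_prodMk_of_tendstoInMeasure_const
    (g := fun p : E × F => G' p.1 + ‖p.1‖ • p.2) (by fun_prop) hrS
    (fun n => hr.comp_aemeasurable (hS n))
  simp only [smul_zero, add_zero] at this
  convert! this using 3 with n ω
  simp only [r, norm_smul, Real.norm_of_nonneg (ha n), smul_smul, map_smul]
  by_cases h : S n ω - e = 0
  · rw [sub_eq_zero] at h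
    simp [h]
  · have : ‖S n ω - e‖ ≠ 0 := norm_ne_zero_iff.2 h
    rw [mul_assoc, mul_inv_cancel₀ this, mul_one, ← smul_add]
    congr 1
    abel

/-- The adjoint moves `M` onto the argument: the characteristic function of the image at `t` is the
original one at `Mᵀ t`. -/
lemma multivariateGaussian_map_clm [DecidableEq ι] {κ : Type*} [Fintype κ] [DecidableEq κ]
    {S : Matrix ι ι ℝ} (hS : S.PosSemidef) (M : Matrix κ ι ℝ)
    {L : EuclideanSpace ℝ ι →L[ℝ] EuclideanSpace ℝ κ}
    (hL : ∀ x, (L x).ofLp = M.mulVec x.ofLp) :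
    (multivariateGaussian 0 S).map L = multivariateGaussian 0 (M * S * M.transpose) := by
  have hS' : (M * S * M.transpose).PosSemidef := by
    simpa using hS.mul_mul_conjTranspose_same M
  apply Measure.ext_of_charFun (E := EuclideanSpace ℝ κ)
  ext t
  have hadj : ∀ x, ⟪L x, t⟫ = ⟪x, WithLp.toLp 2 (M.transpose.mulVec t.ofLp)⟫ := by
    intro x
    simp only [EuclideanSpace.inner_eq_star_dotProduct, star_trivial, hL]
    rw [Matrix.mulVec_transpose, ← Matrix.dotProduct_mulVec]
  have : charFun ((multivariateGaussian 0 S).map L) t =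
      charFun (multivariateGaussian 0 S) (WithLp.toLp 2 (M.transpose.mulVec t.ofLp)) := by
    rw [charFun_apply, charFun_apply, integral_map (by fun_prop) (by fun_prop)]
    simp_rw [hadj]
  rw [this, charFun_multivariateGaussian hS, charFun_multivariateGaussian hS']
  simp only [inner_zero_right]
  congr 4
  rw [← Matrix.mulVec_mulVec, ← Matrix.mulVec_mulVec, Matrix.mulVec_transpose,
    Matrix.dotProduct_mulVec t.ofLp M]

end Limit

/-! ### Affine invariance of the sample correlations -/

section SampleAlgebra

/-- Central empirical moments are expanded in raw ones by feeding this a list of coefficients and a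
list of monomials. -/
lemma sampleMean_sum_smul (n : ℕ) {κ : Type*} (s : Finset κ) (c : κ → ℝ) (f : κ → ℕ → ℝ) :
    sampleMean n (fun i => ∑ k ∈ s, c k * f k i) = ∑ k ∈ s, c k * sampleMean n (f k) := by
  simp only [sampleMean]
  rw [Finset.sum_comm, Finset.sum_div]
  exact Finset.sum_congr rfl fun k _ => by rw [← Finset.mul_sum, mul_div_assoc]

lemma sampleMean_affine {n : ℕ} (hn : n ≠ 0) (a s : ℝ) (u : ℕ → ℝ) :
    sampleMean n (fun i => a + s * u i) = a + s * sampleMean n u := by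
  have : (n : ℝ) ≠ 0 := by exact_mod_cast hn
  simp only [sampleMean, Finset.sum_add_distrib, ← Finset.mul_sum, Finset.sum_const,
    Finset.card_range, nsmul_eq_mul]
  field_simp

lemma sampleCov_affine (n : ℕ) (a s b t : ℝ) (u v : ℕ → ℝ) :
    sampleCov n (fun i => a + s * u i) (fun i => b + t * v i) = s * t * sampleCov n u v := by
  rcases eq_or_ne n 0 with rfl | hn
  · simp [sampleCov]
  · simp only [sampleCov, sampleMean_affine hn]
    rw [← mul_div_assoc, Finset.mul_sum]
    congr 1
    exact Finset.sum_congr rfl fun i _ => by ring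

lemma sampleSd_affine (n : ℕ) (a : ℝ) {s : ℝ} (hs : 0 ≤ s) (u : ℕ → ℝ) :
    sampleSd n (fun i => a + s * u i) = s * sampleSd n u := by
  rw [sampleSd, sampleCov_affine, Real.sqrt_mul (mul_nonneg hs hs), Real.sqrt_mul_self hs, sampleSd]

lemma sampleCorr_affine (n : ℕ) (a b : ℝ) {s t : ℝ} (hs : 0 < s) (ht : 0 < t) (u v : ℕ → ℝ) :
    sampleCorr n (fun i => a + s * u i) (fun i => b + t * v i) = sampleCorr n u v := by
  rw [sampleCorr, sampleCov_affine, sampleSd_affine n a hs.le, sampleSd_affine n b ht.le,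
    sampleCorr, mul_mul_mul_comm, mul_div_mul_left _ _ (mul_pos hs ht).ne']

lemma sampleCov_eq (n : ℕ) (x y : ℕ → ℝ) :
    sampleCov n x y = sampleMean n (fun i => x i * y i) - sampleMean n x * sampleMean n y := by
  rcases eq_or_ne n 0 with rfl | hn
  · simp [sampleCov, sampleMean]
  · have hn' : (n : ℝ) ≠ 0 := by exact_mod_cast hn
    have h1 : sampleMean n (fun _ => 1) = 1 := by simp [sampleMean, hn']
    set a := sampleMean n x with ha
    set b := sampleMean n y with hb
    have := sampleMean_sum_smul n Finset.univ ![1, -b, -a, a * b]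
      ![fun i => x i * y i, x, y, fun _ => 1]
    simp only [Fin.sum_univ_four, Matrix.cons_val, h1, ← ha, ← hb] at this
    trans sampleMean n fun i => (x i - a) * (y i - b)
    · rfl
    · convert! this using 1
      · congr 1
        ext i
        ring
      · ring

lemma sampleCorr_congr {n : ℕ} {x x' y y' : ℕ → ℝ} (hx : ∀ i < n, x i = x' i)
    (hy : ∀ i < n, y i = y' i) : sampleCorr n x y = sampleCorr n x' y' := by
  have hm : ∀ {z z' : ℕ → ℝ}, (∀ i < n, z i = z' i) → sampleMean n z = sampleMean n z' :=
    fun h => by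
      rw [sampleMean, sampleMean, Finset.sum_congr rfl fun i hi => h i (Finset.mem_range.1 hi)]
  simp only [sampleCorr, sampleSd, sampleCov_eq]
  rw [hm hx, hm hy, hm fun i hi => congrArg₂ (· * ·) (hx i hi) (hy i hi),
    hm fun i hi => congrArg₂ (· * ·) (hx i hi) (hx i hi),
    hm fun i hi => congrArg₂ (· * ·) (hy i hi) (hy i hi)]

lemma sampleCov_self_nonneg (n : ℕ) (x : ℕ → ℝ) : 0 ≤ sampleCov n x x :=
  div_nonneg (Finset.sum_nonneg fun _ _ => mul_self_nonneg _) n.cast_nonneg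

lemma eq_sampleMean_of_sampleSd_eq_zero {n : ℕ} {x : ℕ → ℝ} (h : sampleSd n x = 0) :
    ∀ i < n, x i = sampleMean n x := by
  intro i hi
  have hn : (n : ℝ) ≠ 0 := by
    have : n ≠ 0 := by omega
    exact_mod_cast this
  rw [sampleSd, Real.sqrt_eq_zero (sampleCov_self_nonneg n x), sampleCov, div_eq_zero_iff,
    or_iff_left hn, Finset.sum_eq_zero_iff_of_nonneg fun _ _ => mul_self_nonneg _] at h
  have := h i (Finset.mem_range.2 hi)
  rw [mul_self_eq_zero] at this
  linarith

lemma sampleCorr_zero_left (n : ℕ) (y : ℕ → ℝ) : sampleCorr n (fun _ => 0) y = 0 := by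
  simp [sampleCorr, sampleCov, sampleMean]

lemma sampleCorr_zero_right (n : ℕ) (x : ℕ → ℝ) : sampleCorr n x (fun _ => 0) = 0 := by
  simp [sampleCorr, sampleCov, sampleMean]

/-- Normalizing by the empirical standard deviations does not change the sample correlation of the
squared deviations. -/
lemma rho2Hat_eq (n : ℕ) (x y : ℕ → ℝ) :
    rho2Hat n x y = sampleCorr n (fun i => (x i - sampleMean n x) ^ 2)
      (fun i => (y i - sampleMean n y) ^ 2) := by
  unfold rho2Hat sampleStandardize
  -- If a standard deviation is 0, the standardized values are 0 by the division convention and the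
  -- first `n` deviations are genuinely 0, so both correlations are 0.
  rcases eq_or_ne (sampleSd n x) 0 with hx | hx
  · have h0 : ∀ i < n, (x i - sampleMean n x) ^ 2 = 0 := fun i hi => by
      rw [← eq_sampleMean_of_sampleSd_eq_zero hx i hi, sub_self, sq, zero_mul]
    rw [sampleCorr_congr (x' := fun _ => 0) (fun i _ => by simp [hx]) (fun i _ => rfl),
      sampleCorr_congr h0 (fun i _ => rfl), sampleCorr_zero_left, sampleCorr_zero_left]
  rcases eq_or_ne (sampleSd n y) 0 with hy | hy
  · have h0 : ∀ i < n, (y i - sampleMean n y) ^ 2 = 0 := fun i hi => by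
      rw [← eq_sampleMean_of_sampleSd_eq_zero hy i hi, sub_self, sq, zero_mul]
    rw [sampleCorr_congr (y' := fun _ => 0) (fun i _ => rfl) (fun i _ => by simp [hy]),
      sampleCorr_congr (fun i _ => rfl) h0, sampleCorr_zero_right, sampleCorr_zero_right]
  refine Eq.trans ?_ (sampleCorr_affine n 0 0 (s := (sampleSd n x ^ 2)⁻¹)
    (t := (sampleSd n y ^ 2)⁻¹) (by positivity) (by positivity) _ _)
  exact sampleCorr_congr (fun i _ => by rw [div_pow]; ring) (fun i _ => by rw [div_pow]; ring)

lemma rho1Hat_affine (n : ℕ) (a b : ℝ) {s t : ℝ} (hs : 0 < s) (ht : 0 < t) (u v : ℕ → ℝ) :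
    rho1Hat n (fun i => a + s * u i) (fun i => b + t * v i) = rho1Hat n u v :=
  sampleCorr_affine n a b hs ht u v

/-- With `a`, `b` the population means and `s`, `t` the population standard deviations, this and
`rho1Hat_affine` reduce raw data to standardized data. -/
lemma rho2Hat_affine (n : ℕ) (a b : ℝ) {s t : ℝ} (hs : 0 < s) (ht : 0 < t) (u v : ℕ → ℝ) :
    rho2Hat n (fun i => a + s * u i) (fun i => b + t * v i) = rho2Hat n u v := by
  rw [rho2Hat_eq, rho2Hat_eq]
  refine Eq.trans ?_ (sampleCorr_affine n 0 0 (pow_pos hs 2) (pow_pos ht 2) _ _)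
  -- The empty sample has mean 0, which is not affine equivariant, so it is treated apart.
  rcases eq_or_ne n 0 with rfl | hn
  · simp [sampleCorr, sampleCov]
  · rw [sampleMean_affine hn, sampleMean_affine hn]
    exact sampleCorr_congr (fun i _ => by ring) (fun i _ => by ring)

end SampleAlgebra

/-! ### The correlations as a function of the raw moments -/

section MomentMap

/-- The twelve monomials evaluated at `(u, v)`. -/
noncomputable def monomialVec (u v : ℝ) : EuclideanSpace ℝ (Fin 12) :=
  WithLp.toLp 2 fun i => u ^ (exponents i).1 * v ^ (exponents i).2

/-- The vector of the twelve empirical moments. -/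
noncomputable def sampleMoments (n : ℕ) (u v : ℕ → ℝ) : EuclideanSpace ℝ (Fin 12) :=
  (n : ℝ)⁻¹ • ∑ i ∈ Finset.range n, monomialVec (u i) (v i)

/-- `N / √(D₁ D₂)`, written as a correlation. -/
noncomputable def corrQuot (N D₁ D₂ : ℝ) : ℝ := N / (Real.sqrt D₁ * Real.sqrt D₂)

/-- The first variable's second-order central moment as a function of the raw moments. -/
def central20 (s : EuclideanSpace ℝ (Fin 12)) : ℝ := s 2 - s 0 * s 0

/-- The second variable's second-order central moment as a function of the raw moments. -/
def central02 (s : EuclideanSpace ℝ (Fin 12)) : ℝ := s 3 - s 1 * s 1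

/-- The mixed second-order central moment as a function of the raw moments. -/
def central11 (s : EuclideanSpace ℝ (Fin 12)) : ℝ := s 4 - s 0 * s 1

/-- The first variable's fourth-order central moment as a function of the raw moments. -/
def central40 (s : EuclideanSpace ℝ (Fin 12)) : ℝ :=
  s 9 - 4 * (s 0 * s 5) + 6 * (s 0 * s 0 * s 2) - 3 * (s 0 * s 0 * (s 0 * s 0))

/-- The second variable's fourth-order central moment as a function of the raw moments. -/
def central04 (s : EuclideanSpace ℝ (Fin 12)) : ℝ :=
  s 10 - 4 * (s 1 * s 6) + 6 * (s 1 * s 1 * s 3) - 3 * (s 1 * s 1 * (s 1 * s 1))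

/-- The mixed fourth-order central moment as a function of the raw moments. -/
def central22 (s : EuclideanSpace ℝ (Fin 12)) : ℝ :=
  s 11 - 2 * (s 0 * s 8) - 2 * (s 1 * s 7) + s 0 * s 0 * s 3 + s 1 * s 1 * s 2
    + 4 * (s 0 * s 1 * s 4) - 3 * (s 0 * s 0 * (s 1 * s 1))

/-- The pair of correlation coefficients as a function of the raw moments. -/
noncomputable def corrMap (s : EuclideanSpace ℝ (Fin 12)) : EuclideanSpace ℝ (Fin 2) :=
  !₂[corrQuot (central11 s) (central20 s) (central02 s),
    corrQuot (central22 s - central20 s * central02 s) (central40 s - central20 s * central20 s)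
      (central04 s - central02 s * central02 s)]

lemma sampleMoments_apply (n : ℕ) (u v : ℕ → ℝ) (j : Fin 12) :
    sampleMoments n u v j =
      sampleMean n (fun i => u i ^ (exponents j).1 * v i ^ (exponents j).2) := by
  simp [sampleMoments, monomialVec, sampleMean, div_eq_inv_mul]

lemma sampleMean_sq_dev (n : ℕ) (u v : ℕ → ℝ) :
    sampleMean n (fun i => (u i - sampleMean n u) ^ 2) = central20 (sampleMoments n u v) := by
  have h := sampleCov_eq n u u
  simp only [central20, sampleMoments_apply]
  simp only [exponents, Matrix.cons_val, pow_zero, pow_one, mul_one]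
  simp only [sq]
  rw [← h]
  rfl

lemma sampleMean_sq_dev_right (n : ℕ) (u v : ℕ → ℝ) :
    sampleMean n (fun i => (v i - sampleMean n v) ^ 2) = central02 (sampleMoments n u v) := by
  have h := sampleCov_eq n v v
  simp only [central02, sampleMoments_apply]
  simp only [exponents, Matrix.cons_val, pow_zero, pow_one, one_mul]
  simp only [sq]
  rw [← h]
  rfl

lemma sampleCov_eq_central11 (n : ℕ) (u v : ℕ → ℝ) :
    sampleCov n u v = central11 (sampleMoments n u v) := by
  simp only [central11, sampleMoments_apply, sampleCov_eq]
  simp only [exponents, Matrix.cons_val, pow_zero, pow_one, one_mul, mul_one]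

lemma sampleMean_quartic_dev (n : ℕ) (u v : ℕ → ℝ) :
    sampleMean n (fun i => (u i - sampleMean n u) ^ 2 * (u i - sampleMean n u) ^ 2) =
      central40 (sampleMoments n u v) := by
  rcases eq_or_ne n 0 with rfl | hn
  · simp [sampleMean, central40, sampleMoments]
  have hn' : (n : ℝ) ≠ 0 := by exact_mod_cast hn
  have h1 : sampleMean n (fun _ => 1) = 1 := by simp [sampleMean, hn']
  set a := sampleMean n u with ha
  -- Binomial coefficients of `(u - a) ^ 4`. As the mean of `u` is `a`, the last two terms merge
  -- into `-3 * a ^ 4`.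
  have := sampleMean_sum_smul n Finset.univ ![1, -4 * a, 6 * a ^ 2, -4 * a ^ 3, a ^ 4]
    ![fun i => u i ^ 4, fun i => u i ^ 3, fun i => u i ^ 2, u, fun _ => 1]
  simp only [Fin.sum_univ_five, Matrix.cons_val, h1, ← ha] at this
  simp only [central40, sampleMoments_apply]
  simp only [exponents, Matrix.cons_val, pow_zero, pow_one, mul_one, ← ha]
  convert! this using 1
  · congr 1
    ext i
    ring
  · ring

lemma sampleMean_quartic_dev_right (n : ℕ) (u v : ℕ → ℝ) :
    sampleMean n (fun i => (v i - sampleMean n v) ^ 2 * (v i - sampleMean n v) ^ 2) =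
      central04 (sampleMoments n u v) := by
  rw [sampleMean_quartic_dev n v u]
  simp only [central40, central04, sampleMoments_apply]
  simp only [exponents, Matrix.cons_val, pow_zero, pow_one, mul_one, one_mul]

lemma sampleMean_mixed_dev (n : ℕ) (u v : ℕ → ℝ) :
    sampleMean n (fun i => (u i - sampleMean n u) ^ 2 * (v i - sampleMean n v) ^ 2) =
      central22 (sampleMoments n u v) := by
  rcases eq_or_ne n 0 with rfl | hn
  · simp [sampleMean, central22, sampleMoments]
  have hn' : (n : ℝ) ≠ 0 := by exact_mod_cast hn
  have h1 : sampleMean n (fun _ => 1) = 1 := by simp [sampleMean, hn']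
  set a := sampleMean n u with ha
  set b := sampleMean n v with hb
  -- Coefficients of `(u - a) ^ 2 * (v - b) ^ 2`.
  have := sampleMean_sum_smul n Finset.univ
    ![1, -2 * b, b ^ 2, -2 * a, 4 * a * b, -2 * a * b ^ 2, a ^ 2, -2 * a ^ 2 * b, a ^ 2 * b ^ 2]
    ![fun i => u i ^ 2 * v i ^ 2, fun i => u i ^ 2 * v i, fun i => u i ^ 2,
      fun i => u i * v i ^ 2, fun i => u i * v i, u, fun i => v i ^ 2, v, fun _ => 1]
  simp only [Fin.sum_univ_succ, Fin.sum_univ_zero, Matrix.cons_val_zero,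
    Matrix.cons_val_succ, h1, ← ha, ← hb] at this
  simp only [central22, sampleMoments_apply]
  simp only [exponents, Matrix.cons_val, pow_zero, pow_one, mul_one, one_mul, ← ha, ← hb]
  convert! this using 1
  · congr 1
    ext i
    ring
  · ring

/-- Both sides use the same convention for zero denominators, so no exceptional samples have to be
excluded in the limit theorem. -/
lemma corrMap_sampleMoments (n : ℕ) (u v : ℕ → ℝ) :
    corrMap (sampleMoments n u v) = !₂[rho1Hat n u v, rho2Hat n u v] := by
  have h20 : sampleCov n u u = central20 (sampleMoments n u v) := by
    rw [← sampleMean_sq_dev]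
    simp only [sq]
    rfl
  have h02 : sampleCov n v v = central02 (sampleMoments n u v) := by
    rw [← sampleMean_sq_dev_right]
    simp only [sq]
    rfl
  rw [rho2Hat_eq]
  simp only [corrMap, rho1Hat, sampleCorr, sampleSd, corrQuot]
  rw [← sampleCov_eq_central11, ← h20, ← h02]
  simp only [sampleCov_eq n (fun i => (_ : ℝ) ^ 2), sampleMean_sq_dev n u v,
    sampleMean_sq_dev_right n u v, sampleMean_quartic_dev n u v,
    sampleMean_quartic_dev_right n u v, sampleMean_mixed_dev n u v, h20, h02]

lemma measurable_corrMap : Measurable corrMap := by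
  have hc : ∀ i : Fin 12, Measurable fun s : EuclideanSpace ℝ (Fin 12) => s i := fun i =>
    (EuclideanSpace.proj (𝕜 := ℝ) i).measurable
  have h20 : Measurable central20 := by unfold central20; fun_prop
  have h02 : Measurable central02 := by unfold central02; fun_prop
  have h11 : Measurable central11 := by unfold central11; fun_prop
  have h40 : Measurable central40 := by unfold central40; fun_prop
  have h04 : Measurable central04 := by unfold central04; fun_prop
  have h22 : Measurable central22 := by unfold central22; fun_prop
  refine (WithLp.measurable_toLp 2 (Fin 2 → ℝ)).comp (measurable_pi_iff.2 fun i => ?_)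
  fin_cases i <;> simp only [corrQuot] <;> simp <;> fun_prop

end MomentMap

/-! ### Differential of the correlation map -/

section Derivative

/-- The differential of a correlation-type quotient. -/
lemma hasFDerivAt_corrQuot {E : Type*} [NormedAddCommGroup E] [NormedSpace ℝ E]
    {N D₁ D₂ : E → ℝ} {N' D₁' D₂' : E →L[ℝ] ℝ} {e : E} (hN : HasFDerivAt N N' e)
    (h₁ : HasFDerivAt D₁ D₁' e) (h₂ : HasFDerivAt D₂ D₂' e) (hp₁ : 0 < D₁ e) (hp₂ : 0 < D₂ e) :
    HasFDerivAt (fun s => corrQuot (N s) (D₁ s) (D₂ s))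
      ((1 / Real.sqrt (D₁ e * D₂ e)) • N'
        - (corrQuot (N e) (D₁ e) (D₂ e) / (2 * D₁ e)) • D₁'
        - (corrQuot (N e) (D₁ e) (D₂ e) / (2 * D₂ e)) • D₂') e := by
  have hs₁ := Real.sqrt_pos.2 hp₁
  have hs₂ := Real.sqrt_pos.2 hp₂
  have h := hN.mul ((hasDerivAt_inv (mul_pos hs₁ hs₂).ne').comp_hasFDerivAt e
    ((h₁.sqrt hp₁.ne').mul (h₂.sqrt hp₂.ne')))
  refine h.congr_fderiv ?_
  ext x
  simp only [corrQuot, Real.sqrt_mul hp₁.le]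
  -- Writing the denominators as squares of their roots leaves an identity of rational functions.
  have e₁ := Real.sq_sqrt hp₁.le
  have e₂ := Real.sq_sqrt hp₂.le
  set a := Real.sqrt (D₁ e)
  set b := Real.sqrt (D₂ e)
  rw [← e₁, ← e₂]
  simp
  field_simp
  ring

/-- The differential of the map from raw moments to the correlations. -/
lemma hasFDerivAt_corrMap {e : EuclideanSpace ℝ (Fin 12)} (h0 : e 0 = 0) (h1 : e 1 = 0)
    (h2 : e 2 = 1) (h3 : e 3 = 1) (h9 : 0 < e 9 - 1) (h10 : 0 < e 10 - 1)
    {L : EuclideanSpace ℝ (Fin 12) →L[ℝ] EuclideanSpace ℝ (Fin 2)}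
    (hL0 : ∀ x, L x 0 = -e 4 / 2 * x 2 - e 4 / 2 * x 3 + x 4)
    (hL1 : ∀ x, L x 1 = (1 / Real.sqrt ((e 9 - 1) * (e 10 - 1))) *
        (x 11 - 2 * e 8 * x 0 - 2 * e 7 * x 1 - x 2 - x 3)
      - (e 11 - 1) / Real.sqrt ((e 9 - 1) * (e 10 - 1)) / (2 * (e 9 - 1)) *
        (x 9 - 4 * e 5 * x 0 - 2 * x 2)
      - (e 11 - 1) / Real.sqrt ((e 9 - 1) * (e 10 - 1)) / (2 * (e 10 - 1)) *
        (x 10 - 4 * e 6 * x 1 - 2 * x 3)) :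
    HasFDerivAt corrMap L e := by
  have p : ∀ i : Fin 12, HasFDerivAt (fun s : EuclideanSpace ℝ (Fin 12) => s i)
      (EuclideanSpace.proj (𝕜 := ℝ) i) e := fun i =>
    (EuclideanSpace.proj (𝕜 := ℝ) i).hasFDerivAt
  have d20 := (p 2).sub ((p 0).mul (p 0))
  have d02 := (p 3).sub ((p 1).mul (p 1))
  have d11 := (p 4).sub ((p 0).mul (p 1))
  have d40 := (((p 9).sub (((p 0).mul (p 5)).const_mul 4)).add
    ((((p 0).mul (p 0)).mul (p 2)).const_mul 6)).sub
      ((((p 0).mul (p 0)).mul ((p 0).mul (p 0))).const_mul 3)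
  have d04 := (((p 10).sub (((p 1).mul (p 6)).const_mul 4)).add
    ((((p 1).mul (p 1)).mul (p 3)).const_mul 6)).sub
      ((((p 1).mul (p 1)).mul ((p 1).mul (p 1))).const_mul 3)
  have d22 := (((((((p 11).sub (((p 0).mul (p 8)).const_mul 2))).sub
    (((p 1).mul (p 7)).const_mul 2)).add (((p 0).mul (p 0)).mul (p 3))).add
    (((p 1).mul (p 1)).mul (p 2))).add ((((p 0).mul (p 1)).mul (p 4)).const_mul 4)).sub
    ((((p 0).mul (p 0)).mul ((p 1).mul (p 1))).const_mul 3)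
  -- The central moments are defined with products instead of powers, so that these derivatives
  -- match them definitionally.
  change HasFDerivAt central20 _ e at d20
  change HasFDerivAt central02 _ e at d02
  change HasFDerivAt central11 _ e at d11
  change HasFDerivAt central40 _ e at d40
  change HasFDerivAt central04 _ e at d04
  change HasFDerivAt central22 _ e at d22
  have v20 : central20 e = 1 := by simp [central20, h0, h2]
  have v02 : central02 e = 1 := by simp [central02, h1, h3]
  have v11 : central11 e = e 4 := by simp [central11, h0]
  have v40 : central40 e = e 9 := by simp [central40, h0]
  have v04 : central04 e = e 10 := by simp [central04, h1]
  have v22 : central22 e = e 11 := by simp [central22, h0, h1]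
  rw [← hasFDerivWithinAt_univ, hasFDerivWithinAt_euclidean]
  intro i
  rw [hasFDerivWithinAt_univ]
  fin_cases i
  · refine (hasFDerivAt_corrQuot d11 d20 d02 (by simp [v20]) (by simp [v02])).congr_fderiv ?_
    ext x
    simp [v20, v02, v11, h0, h1, hL0, corrQuot]
    ring
  · refine (hasFDerivAt_corrQuot (d22.sub (d20.mul d02)) (d40.sub (d20.mul d20))
      (d04.sub (d02.mul d02)) ?_ ?_).congr_fderiv ?_
    · simpa [v20, v40] using h9
    · simpa [v02, v04] using h10
    · ext x
      simp [v20, v02, v40, v04, v22, h0, h1, h2, h3, hL1, corrQuot, Real.sqrt_mul h9.le]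
      ring

end Derivative

/-! ### Standardized moments and the matrix `M` -/

section Population

variable {Ω : Type*} [MeasurableSpace Ω] {μ : Measure Ω} {X Y : Ω → ℝ}

/-- With `m = max |u| |v|`, the monomial is at most `m ^ (k + l) ≤ 1 + m ^ 8`. One integrable bound
thus serves all mixed moments of order at most 8. -/
lemma abs_pow_mul_pow_le {u v : ℝ} {k l : ℕ} (h : k + l ≤ 8) :
    |u ^ k * v ^ l| ≤ 1 + u ^ 8 + v ^ 8 := by
  have h8 : ∀ x : ℝ, x ^ 8 = |x| ^ 8 := fun x => (Even.pow_abs (by decide) x).symm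
  rw [abs_mul, abs_pow, abs_pow, h8 u, h8 v]
  set m := max |u| |v|
  have hm : 0 ≤ m := (abs_nonneg u).trans (le_max_left _ _)
  have h1 : |u| ^ k * |v| ^ l ≤ m ^ (k + l) := by
    rw [pow_add]
    gcongr
    exacts [le_max_left _ _, le_max_right _ _]
  have h2 : m ^ (k + l) ≤ 1 + m ^ 8 := by
    rcases le_total m 1 with h' | h'
    · linarith [pow_le_one₀ (n := k + l) hm h', pow_nonneg hm 8]
    · linarith [pow_le_pow_right₀ h' h]
  have h3 : m ^ 8 ≤ |u| ^ 8 + |v| ^ 8 := by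
    rcases max_choice |u| |v| with h' | h' <;> simp only [m, h'] <;>
      nlinarith [pow_nonneg (abs_nonneg u) 8, pow_nonneg (abs_nonneg v) 8]
  linarith

lemma memLp_eight (hX : AEMeasurable X μ) (hX8 : Integrable (fun ω => X ω ^ 8) μ) :
    MemLp X 8 μ := by
  rw [← integrable_norm_rpow_iff hX.aestronglyMeasurable (by norm_num) (by norm_num)]
  convert! hX8 with ω
  norm_num
  exact Even.pow_abs (by decide) _

lemma memLp_two [IsProbabilityMeasure μ]
    (hX : AEMeasurable X μ) (hX8 : Integrable (fun ω => X ω ^ 8) μ) :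
    MemLp X 2 μ := (memLp_eight hX hX8).mono_exponent (by norm_num)

lemma aemeasurable_standardize (hX : AEMeasurable X μ) : AEMeasurable (standardize μ X) μ :=
  (hX.sub_const _).div_const _

lemma integrable_standardize_pow_eight [IsProbabilityMeasure μ] (hX : AEMeasurable X μ)
    (hX8 : Integrable (fun ω => X ω ^ 8) μ) :
    Integrable (fun ω => standardize μ X ω ^ 8) μ := by
  have h : MemLp (standardize μ X) 8 μ := by
    have := ((memLp_eight hX hX8).sub (memLp_const (∫ ω, X ω ∂μ))).mul_const
      (Real.sqrt (variance X μ))⁻¹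
    simpa only [div_eq_mul_inv] using! this
  convert! h.integrable_norm_pow (p := 8) (by norm_num) using 2 with ω
  exact (Even.pow_abs (n := 8) (by decide) (standardize μ X ω)).symm

lemma variance_pos [IsProbabilityMeasure μ]
    (hX : AEMeasurable X μ) (hX8 : Integrable (fun ω => X ω ^ 8) μ)
    (hXc : ¬ AEConst μ X) : 0 < variance X μ := by
  refine lt_of_le_of_ne (variance_nonneg _ _) fun h => hXc ⟨∫ ω, X ω ∂μ, ?_⟩
  exact ae_eq_integral_of_variance_eq_zero (memLp_two hX hX8) h.symm

/-- A random variable with finite eighth moment that is not almost surely constant. -/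
structure EighthMoment (μ : Measure Ω) (X : Ω → ℝ) : Prop where
  aemeasurable : AEMeasurable X μ
  integrable : Integrable (fun ω => X ω ^ 8) μ
  not_aeConst : ¬ AEConst μ X

lemma integrable_stdMonomial [IsProbabilityMeasure μ]
    (hX : EighthMoment μ X) (hY : EighthMoment μ Y) {p : ℕ × ℕ}
    (hp : p.1 + p.2 ≤ 8) : Integrable (stdMonomial μ X Y p) μ := by
  refine Integrable.mono' (((integrable_const 1).add
    (integrable_standardize_pow_eight hX.1 hX.2)).add
    (integrable_standardize_pow_eight hY.1 hY.2)) ?_ (ae_of_all _ fun ω => abs_pow_mul_pow_le hp)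
  exact (((aemeasurable_standardize hX.1).pow_const _).mul
    ((aemeasurable_standardize hY.1).pow_const _)).aestronglyMeasurable

/-- Squaring doubles the degree to at most 8: this is where eighth moments are needed. -/
lemma memLp_stdMonomial [IsProbabilityMeasure μ]
    (hX : EighthMoment μ X) (hY : EighthMoment μ Y) {p : ℕ × ℕ}
    (hp : p.1 + p.2 ≤ 4) : MemLp (stdMonomial μ X Y p) 2 μ := by
  have h := integrable_stdMonomial hX hY (p := p) (by omega)
  rw [memLp_two_iff_integrable_sq h.aestronglyMeasurable]
  convert! integrable_stdMonomial hX hY (p := (2 * p.1, 2 * p.2)) (by simp; omega) using 2 with ω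
  simp only [stdMonomial]
  ring

lemma covariance_stdMonomial [IsProbabilityMeasure μ]
    (hX : EighthMoment μ X) (hY : EighthMoment μ Y) {p q : ℕ × ℕ}
    (hp : p.1 + p.2 ≤ 4) (hq : q.1 + q.2 ≤ 4) :
    covariance (stdMonomial μ X Y p) (stdMonomial μ X Y q) μ =
      stdMoment μ X Y (p.1 + q.1) (p.2 + q.2) -
        stdMoment μ X Y p.1 p.2 * stdMoment μ X Y q.1 q.2 := by
  rw [covariance_eq_sub (memLp_stdMonomial hX hY hp) (memLp_stdMonomial hX hY hq)]
  simp only [stdMoment]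
  congr 1
  refine integral_congr_ae (ae_of_all _ fun ω => ?_)
  simp only [stdMonomial, Pi.mul_apply]
  ring

lemma exponents_le (i : Fin 12) : (exponents i).1 + (exponents i).2 ≤ 4 := by
  fin_cases i <;> simp [exponents]

lemma SigmaM_apply [IsProbabilityMeasure μ]
    (hX : EighthMoment μ X) (hY : EighthMoment μ Y) (i j : Fin 12) :
    SigmaM μ X Y i j =
      stdMoment μ X Y ((exponents i).1 + (exponents j).1) ((exponents i).2 + (exponents j).2) -
        stdMoment μ X Y (exponents i).1 (exponents i).2 *
          stdMoment μ X Y (exponents j).1 (exponents j).2 :=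
  covariance_stdMonomial hX hY (exponents_le i) (exponents_le j)

lemma stdMoment_comm (k l : ℕ) : stdMoment μ X Y k l = stdMoment μ Y X l k := by
  simp only [stdMoment, stdMonomial, mul_comm]

lemma stdMoment_zero_right (k : ℕ) :
    stdMoment μ X Y k 0 = ∫ ω, standardize μ X ω ^ k ∂μ := by
  simp [stdMoment, stdMonomial]

lemma stdMoment_zero_left (l : ℕ) :
    stdMoment μ X Y 0 l = ∫ ω, standardize μ Y ω ^ l ∂μ := by
  simp [stdMoment, stdMonomial]

lemma integral_standardize [IsProbabilityMeasure μ]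
    (hX : EighthMoment μ X) : ∫ ω, standardize μ X ω ∂μ = 0 := by
  have h := (memLp_two hX.1 hX.2).integrable (by norm_num)
  simp only [standardize]
  rw [integral_div, integral_sub h (integrable_const _)]
  simp

lemma integral_standardize_sq [IsProbabilityMeasure μ]
    (hX : EighthMoment μ X) : ∫ ω, standardize μ X ω ^ 2 ∂μ = 1 := by
  have hv := variance_pos hX.1 hX.2 hX.3
  simp only [standardize, div_pow, Real.sq_sqrt hv.le]
  rw [integral_div, ← variance_eq_integral hX.1, div_self hv.ne']

lemma stdMoment_one_zero [IsProbabilityMeasure μ]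
    (hX : EighthMoment μ X) : stdMoment μ X Y 1 0 = 0 := by
  rw [stdMoment_zero_right]
  simpa using integral_standardize hX

lemma stdMoment_zero_one [IsProbabilityMeasure μ]
    (hY : EighthMoment μ Y) : stdMoment μ X Y 0 1 = 0 := by
  rw [stdMoment_comm, stdMoment_one_zero hY]

lemma stdMoment_two_zero [IsProbabilityMeasure μ]
    (hX : EighthMoment μ X) : stdMoment μ X Y 2 0 = 1 := by
  rw [stdMoment_zero_right, integral_standardize_sq hX]

lemma stdMoment_zero_two [IsProbabilityMeasure μ]
    (hY : EighthMoment μ Y) : stdMoment μ X Y 0 2 = 1 := by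
  rw [stdMoment_comm, stdMoment_two_zero hY]

lemma rho1_eq :   rho1 μ X Y = stdMoment μ X Y 1 1 := by
  simp only [rho1, pearson, covariance, stdMoment, stdMonomial, standardize, pow_one]
  rw [← integral_div]
  simp_rw [div_mul_div_comm]

lemma stdMonomial_two_zero :
    stdMonomial μ X Y (2, 0) = fun ω => standardize μ X ω ^ 2 := by
  ext ω
  simp [stdMonomial]

lemma stdMonomial_zero_two :
    stdMonomial μ X Y (0, 2) = fun ω => standardize μ Y ω ^ 2 := by
  ext ω
  simp [stdMonomial]

lemma covariance_standardize_sq [IsProbabilityMeasure μ]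
    (hX : EighthMoment μ X) (hY : EighthMoment μ Y) :
    covariance (fun ω => standardize μ X ω ^ 2) (fun ω => standardize μ Y ω ^ 2) μ =
      stdMoment μ X Y 2 2 - 1 := by
  have := covariance_stdMonomial hX hY (p := (2, 0)) (q := (0, 2)) (by simp) (by simp)
  simp only [stdMoment_two_zero hX, stdMoment_zero_two hY] at this
  simpa only [stdMonomial_two_zero, stdMonomial_zero_two, mul_one] using this

lemma variance_standardize_sq [IsProbabilityMeasure μ] (hX : EighthMoment μ X) :
    variance (fun ω => standardize μ X ω ^ 2) μ = stdMoment μ X Y 4 0 - 1 := by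
  -- The variance is the covariance formula for the pair `(X, X)`, whose moment of index `2 2` is
  -- the fourth moment.
  rw [← covariance_self ((aemeasurable_standardize hX.1).pow_const _),
    covariance_standardize_sq hX hX, stdMoment_zero_right]
  simp only [stdMoment, stdMonomial, ← pow_add]

/-- The quantity is the variance of the squared standardized variable. Its positivity keeps the
denominators of `ρ₂` and of `matB` away from 0. -/
lemma stdMoment_four_zero [IsProbabilityMeasure μ] (hX : EighthMoment μ X)
    (hX2 : ¬ AEConst μ (fun ω => standardize μ X ω ^ 2)) : 0 < stdMoment μ X Y 4 0 - 1 := by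
  rw [← variance_standardize_sq hX]
  refine lt_of_le_of_ne (variance_nonneg _ _) fun h => hX2
    ⟨∫ ω, standardize μ X ω ^ 2 ∂μ, ?_⟩
  refine ae_eq_integral_of_variance_eq_zero ?_ h.symm
  simpa only [stdMonomial_two_zero] using memLp_stdMonomial hX hX (p := (2, 0)) (by simp)

lemma stdMoment_zero_four [IsProbabilityMeasure μ] (hY : EighthMoment μ Y)
    (hY2 : ¬ AEConst μ (fun ω => standardize μ Y ω ^ 2)) : 0 < stdMoment μ X Y 0 4 - 1 := by
  rw [stdMoment_comm]
  exact stdMoment_four_zero hY hY2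

lemma rho2_eq [IsProbabilityMeasure μ] (hX : EighthMoment μ X) (hY : EighthMoment μ Y)
    (hX2 : ¬ AEConst μ (fun ω => standardize μ X ω ^ 2)) :
    rho2 μ X Y = (stdMoment μ X Y 2 2 - 1) /
      Real.sqrt ((stdMoment μ X Y 4 0 - 1) * (stdMoment μ X Y 0 4 - 1)) := by
  rw [rho2, pearson, covariance_standardize_sq hX hY, variance_standardize_sq (Y := Y) hX,
    variance_standardize_sq (Y := X) hY, stdMoment_comm (X := Y),
    Real.sqrt_mul (stdMoment_four_zero hX hX2).le]

/-- The random vector of the twelve monomials in the standardized variables. -/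
noncomputable def stdVec (μ : Measure Ω) (X Y : Ω → ℝ) (ω : Ω) : EuclideanSpace ℝ (Fin 12) :=
  monomialVec (standardize μ X ω) (standardize μ Y ω)

lemma memLp_stdVec [IsProbabilityMeasure μ] (hX : EighthMoment μ X) (hY : EighthMoment μ Y) :
    MemLp (stdVec μ X Y) 2 μ :=
  MemLp.of_eval_piLp fun i => memLp_stdMonomial hX hY (exponents_le i)

lemma covMatrix_stdVec : covMatrix μ (stdVec μ X Y) = SigmaM μ X Y := rfl

lemma integral_stdVec_apply [IsProbabilityMeasure μ]
    (hX : EighthMoment μ X) (hY : EighthMoment μ Y) (i : Fin 12) :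
    (∫ ω, stdVec μ X Y ω ∂μ) i = stdMoment μ X Y (exponents i).1 (exponents i).2 := by
  rw [eval_integral_piLp fun i =>
    (memLp_stdMonomial hX hY (exponents_le i)).integrable (by norm_num)]
  rfl

lemma matM_mulVec_zero (x : Fin 12 → ℝ) :
    (matM μ X Y).mulVec x 0 =
      -rho1 μ X Y / 2 * x 2 - rho1 μ X Y / 2 * x 3 + x 4 := by
  rw [matM, ← Matrix.mulVec_mulVec]
  simp [matA, matB, Matrix.mulVec, dotProduct, Fin.sum_univ_succ]
  ring

/-- `matA` carries `e 4 0`, `e 0 4`, `e 2 2` in the columns of the second moments, as for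
scale-normalized fourth moments, whereas differentiating `corrMap` gives 1 in their place. The
discrepancies are `±ρ₂ * (x 2 + x 3)` and cancel, since a correlation is scale invariant. -/
lemma matM_mulVec_one [IsProbabilityMeasure μ] (hX : EighthMoment μ X) (hY : EighthMoment μ Y)
    (hX2 : ¬ AEConst μ (fun ω => standardize μ X ω ^ 2))
    (hY2 : ¬ AEConst μ (fun ω => standardize μ Y ω ^ 2)) (x : Fin 12 → ℝ) :
    (matM μ X Y).mulVec x 1 =
      let e := stdMoment μ X Y
      let q := Real.sqrt ((e 4 0 - 1) * (e 0 4 - 1))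
      (1 / q) * (x 11 - 2 * e 1 2 * x 0 - 2 * e 2 1 * x 1 - x 2 - x 3)
      - (e 2 2 - 1) / q / (2 * (e 4 0 - 1)) * (x 9 - 4 * e 3 0 * x 0 - 2 * x 2)
      - (e 2 2 - 1) / q / (2 * (e 0 4 - 1)) * (x 10 - 4 * e 0 3 * x 1 - 2 * x 3) := by
  have h4 := stdMoment_four_zero (Y := Y) hX hX2
  have h4' := stdMoment_zero_four (X := X) hY hY2
  have hq := Real.sqrt_pos.2 (mul_pos h4 h4')
  rw [matM, ← Matrix.mulVec_mulVec]
  simp only [matA, matB, rho2_eq hX hY hX2]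
  set e := stdMoment μ X Y
  set q := Real.sqrt ((e 4 0 - 1) * (e 0 4 - 1))
  simp [Matrix.mulVec, dotProduct, Fin.sum_univ_succ]
  have := h4.ne'
  have := h4'.ne'
  field_simp
  ring

/-- Applying `M` twice lets the two sparse row formulas above expand an entry, instead of a full
double sum. -/
lemma SigmaStar_apply (i j : Fin 2) : SigmaStar μ X Y i j =
    (matM μ X Y).mulVec (fun k => (matM μ X Y).mulVec (fun l => SigmaM μ X Y k l) j) i := by
  rw [SigmaStar, Matrix.mul_assoc]
  simp only [Matrix.mul_apply, Matrix.mulVec, dotProduct, Matrix.transpose_apply]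
  simp only [mul_comm]

end Population

/-! ### Joint asymptotic normality -/

section Asymptotics

open scoped Topology

variable {Ω Ω' : Type*} [MeasurableSpace Ω] [MeasurableSpace Ω']
  {μ : Measure Ω} {P : Measure Ω'} [IsProbabilityMeasure P]
  {X Y : Ω → ℝ} {Xs Ys : ℕ → Ω' → ℝ}

lemma measurable_monomialVec : Measurable fun p : ℝ × ℝ => monomialVec p.1 p.2 :=
  (WithLp.measurable_toLp 2 (Fin 12 → ℝ)).comp (measurable_pi_iff.2 fun i => by fun_prop)

/-- The continuous linear map given by the matrix `M`. -/
noncomputable def clmM (μ : Measure Ω) (X Y : Ω → ℝ) :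
    EuclideanSpace ℝ (Fin 12) →L[ℝ] EuclideanSpace ℝ (Fin 2) :=
  LinearMap.toContinuousLinearMap (Matrix.toLpLin 2 2 (matM μ X Y))

lemma clmM_apply (x : EuclideanSpace ℝ (Fin 12)) :
    (clmM μ X Y x).ofLp = (matM μ X Y).mulVec x.ofLp := rfl

variable [IsProbabilityMeasure μ]

lemma sigmaM_posSemidef (hX : EighthMoment μ X) (hY : EighthMoment μ Y) :
    (SigmaM μ X Y).PosSemidef :=
  covMatrix_posSemidef (memLp_stdVec hX hY)

lemma sigmaStar_posSemidef (hX : EighthMoment μ X) (hY : EighthMoment μ Y) :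
    (SigmaStar μ X Y).PosSemidef := by
  simpa [SigmaStar] using (sigmaM_posSemidef hX hY).mul_mul_conjTranspose_same (matM μ X Y)

lemma hasFDerivAt_corrMap_moments (hX : EighthMoment μ X) (hY : EighthMoment μ Y)
    (hX2 : ¬ AEConst μ (fun ω => standardize μ X ω ^ 2))
    (hY2 : ¬ AEConst μ (fun ω => standardize μ Y ω ^ 2)) :
    HasFDerivAt corrMap (clmM μ X Y) (∫ ω, stdVec μ X Y ω ∂μ) := by
  have he := integral_stdVec_apply hX hY
  apply hasFDerivAt_corrMap
  · rw [he]; exact stdMoment_one_zero hX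
  · rw [he]; exact stdMoment_zero_one hY
  · rw [he]; exact stdMoment_two_zero hX
  · rw [he]; exact stdMoment_zero_two hY
  · rw [he]; exact stdMoment_four_zero hX hX2
  · rw [he]; exact stdMoment_zero_four hY hY2
  · intro x
    rw [clmM_apply, matM_mulVec_zero, rho1_eq, he]
    rfl
  · intro x
    rw [clmM_apply, matM_mulVec_one hX hY hX2 hY2]
    simp only [he]
    rfl

lemma corrMap_moments (hX : EighthMoment μ X) (hY : EighthMoment μ Y)
    (hX2 : ¬ AEConst μ (fun ω => standardize μ X ω ^ 2)) :
    corrMap (∫ ω, stdVec μ X Y ω ∂μ) = !₂[rho1 μ X Y, rho2 μ X Y] := by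
  have he := integral_stdVec_apply hX hY
  have h4 := stdMoment_four_zero (Y := Y) hX hX2
  rw [rho1_eq, rho2_eq hX hY hX2, Real.sqrt_mul h4.le]
  simp only [corrMap, corrQuot, central11, central20, central02, central40, central04, central22,
    he]
  simp only [exponents, Matrix.cons_val, stdMoment_one_zero hX, stdMoment_zero_one hY,
    stdMoment_two_zero hX, stdMoment_zero_two hY]
  simp

theorem tendstoInDistribution_correlations (hX : EighthMoment μ X) (hY : EighthMoment μ Y)
    (hX2 : ¬ AEConst μ (fun ω => standardize μ X ω ^ 2))
    (hY2 : ¬ AEConst μ (fun ω => standardize μ Y ω ^ 2))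
    (hindep : iIndepFun (fun i ω => (Xs i ω, Ys i ω)) P)
    (hident : ∀ i, IdentDistrib (fun ω => (Xs i ω, Ys i ω)) (fun ω => (X ω, Y ω)) P μ) :
    TendstoInDistribution
      (fun (n : ℕ) (ω : Ω') => Real.sqrt n •
        (!₂[rho1Hat n (fun i => Xs i ω) (fun i => Ys i ω),
            rho2Hat n (fun i => Xs i ω) (fun i => Ys i ω)] - !₂[rho1 μ X Y, rho2 μ X Y]))
      atTop (id : EuclideanSpace ℝ (Fin 2) → EuclideanSpace ℝ (Fin 2))
      (fun _ => P) (multivariateGaussian 0 (SigmaStar μ X Y)) := by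
  have hsx := Real.sqrt_pos.2 (variance_pos hX.1 hX.2 hX.3)
  have hsy := Real.sqrt_pos.2 (variance_pos hY.1 hY.2 hY.3)
  let φ : ℝ × ℝ → EuclideanSpace ℝ (Fin 12) := fun p =>
    monomialVec ((p.1 - ∫ ω, X ω ∂μ) / Real.sqrt (variance X μ))
      ((p.2 - ∫ ω, Y ω ∂μ) / Real.sqrt (variance Y μ))
  have hφ : Measurable φ := measurable_monomialVec.comp
    (g := fun p : ℝ × ℝ => monomialVec p.1 p.2)
    (f := fun p : ℝ × ℝ => ((p.1 - ∫ ω, X ω ∂μ) / Real.sqrt (variance X μ),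
      (p.2 - ∫ ω, Y ω ∂μ) / Real.sqrt (variance Y μ))) (by fun_prop)
  let Z : ℕ → Ω' → EuclideanSpace ℝ (Fin 12) := fun i ω => φ (Xs i ω, Ys i ω)
  have hZ : iIndepFun Z P := hindep.comp (fun _ => φ) fun _ => hφ
  have hid : ∀ i, IdentDistrib (Z i) (stdVec μ X Y) P μ := fun i => (hident i).comp hφ
  have hid0 : ∀ i, IdentDistrib (Z i) (Z 0) P P := fun i => (hid i).trans (hid 0).symm
  have hL2 := memLp_stdVec hX hY
  set e := ∫ ω, stdVec μ X Y ω ∂μ with he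
  let S : ℕ → Ω' → EuclideanSpace ℝ (Fin 12) := fun n ω =>
    (n : ℝ)⁻¹ • ∑ i ∈ Finset.range n, Z i ω
  have hS : ∀ n, AEMeasurable (S n) P := fun n =>
    (Finset.aemeasurable_fun_sum _ fun k _ => (hid k).aemeasurable_fst).fun_const_smul _
  have hlim : ∀ᵐ ω ∂P, Tendsto (fun n => S n ω) atTop (𝓝 e) := by
    have := strong_law_ae Z ((hid 0).integrable_iff.2 (hL2.integrable (by norm_num)))
      (fun i j hij => hZ.indepFun hij) hid0
    rwa [(hid 0).integral_eq] at this
  have hclt : TendstoInDistribution (fun (n : ℕ) ω => Real.sqrt n • (S n ω - e)) atTop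
      (id : EuclideanSpace ℝ (Fin 12) → EuclideanSpace ℝ (Fin 12)) (fun _ => P)
      (multivariateGaussian 0 (SigmaM μ X Y)) := by
    have := multivariate_clt hL2 hZ hid
    rw [covMatrix_stdVec] at this
    convert! this using 3 with n ω
    rcases eq_or_ne n 0 with rfl | hn
    · simp
    · have hn' : (n : ℝ) ≠ 0 := by exact_mod_cast hn
      have hs : Real.sqrt n ≠ 0 := by positivity
      have h1 : (Real.sqrt n)⁻¹ = Real.sqrt n * (n : ℝ)⁻¹ := by
        field_simp
        rw [Real.sq_sqrt n.cast_nonneg]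
      rw [h1, mul_smul, smul_sub (n : ℝ)⁻¹, smul_smul, inv_mul_cancel₀ hn', one_smul]
  have hdelta := tendstoInDistribution_delta (fun n : ℕ => Real.sqrt_nonneg n) hS hlim hclt
    measurable_corrMap (hasFDerivAt_corrMap_moments hX hY hX2 hY2)
  -- Affine invariance removes the population standardization: the moments are of standardized data,
  -- the estimators of raw data.
  have hfun : ∀ n ω, corrMap (S n ω) = !₂[rho1Hat n (fun i => Xs i ω) (fun i => Ys i ω),
      rho2Hat n (fun i => Xs i ω) (fun i => Ys i ω)] := by
    intro n ω
    have := corrMap_sampleMoments n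
      (fun i => (Xs i ω - ∫ ω, X ω ∂μ) / Real.sqrt (variance X μ))
      (fun i => (Ys i ω - ∫ ω, Y ω ∂μ) / Real.sqrt (variance Y μ))
    rw [← rho1Hat_affine n (∫ ω, X ω ∂μ) (∫ ω, Y ω ∂μ) hsx hsy,
      ← rho2Hat_affine n (∫ ω, X ω ∂μ) (∫ ω, Y ω ∂μ) hsx hsy] at this
    simp only [mul_div_cancel₀ _ hsx.ne', mul_div_cancel₀ _ hsy.ne', add_sub_cancel] at this
    exact this
  have hce : corrMap e = !₂[rho1 μ X Y, rho2 μ X Y] := corrMap_moments hX hY hX2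
  simp only [hfun, hce] at hdelta
  refine ⟨hdelta.forall_aemeasurable, by fun_prop, ?_⟩
  convert! hdelta.tendsto using 1
  -- The two limits differ only in presentation: the identity under the Gaussian law with covariance
  -- `SigmaStar`, and `clmM` under the one with covariance `SigmaM`.
  refine congrArg nhds (Subtype.ext ?_)
  change Measure.map id _ = Measure.map (clmM μ X Y) _
  rw [Measure.map_id, SigmaStar]
  exact (multivariateGaussian_map_clm (sigmaM_posSemidef hX hY) (matM μ X Y) clmM_apply).symm

end Asymptotics

/-! ### Entries of the limit covariance: general and independent cases -/

section Entries

variable {Ω : Type*} [MeasurableSpace Ω] {μ : Measure Ω} {X Y : Ω → ℝ}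

lemma stdMoment_of_indepFun (hX : EighthMoment μ X) (hY : EighthMoment μ Y)
    (h : IndepFun X Y μ) (k l : ℕ) :
    stdMoment μ X Y k l = stdMoment μ X Y k 0 * stdMoment μ X Y 0 l := by
  rw [stdMoment_zero_right, stdMoment_zero_left]
  have hi : IndepFun (fun ω => standardize μ X ω ^ k) (fun ω => standardize μ Y ω ^ l) μ :=
    h.comp (φ := fun x => ((x - ∫ ω', X ω' ∂μ) / Real.sqrt (variance X μ)) ^ k)
      (ψ := fun y => ((y - ∫ ω', Y ω' ∂μ) / Real.sqrt (variance Y μ)) ^ l)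
      (by fun_prop) (by fun_prop)
  exact hi.integral_fun_mul_eq_mul_integral
    ((aemeasurable_standardize hX.1).pow_const _).aestronglyMeasurable
    ((aemeasurable_standardize hY.1).pow_const _).aestronglyMeasurable

variable [IsProbabilityMeasure μ]

/-- The entry is the variance of `U V - (ρ₁ / 2) (U² + V²)` for the standardized pair `(U, V)`, a
variable of mean 0. -/
lemma sigmaStar_zero_zero (hX : EighthMoment μ X) (hY : EighthMoment μ Y) :
    SigmaStar μ X Y 0 0 =
      (stdMoment μ X Y 4 0 + stdMoment μ X Y 0 4 + 2 * stdMoment μ X Y 2 2)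
          * rho1 μ X Y ^ 2 / 4
        - (stdMoment μ X Y 3 1 + stdMoment μ X Y 1 3) * rho1 μ X Y + stdMoment μ X Y 2 2 := by
  rw [SigmaStar_apply]
  simp only [matM_mulVec_zero, SigmaM_apply hX hY]
  simp only [exponents, Matrix.cons_val, stdMoment_two_zero hX, stdMoment_zero_two hY, rho1_eq,
    Nat.reduceAdd]
  ring

lemma sigmaStar_comm (hX : EighthMoment μ X) (hY : EighthMoment μ Y) :
    SigmaStar μ X Y 1 0 = SigmaStar μ X Y 0 1 := by
  have := congrFun (congrFun (sigmaStar_posSemidef hX hY).isHermitian 1) 0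
  simpa using this.symm

/-- Independence kills `ρ₁`, `ρ₂`, `e 1 2` and `e 2 1`. For the standardized pair `(U, V)` and `q`
the root in `τ`, the two linear forms become, up to constants, `U V` and `(U² - 1) (V² - 1) / q`.
Their covariances factor over `U` and `V`. -/
lemma sigmaStar_of_indepFun (hX : EighthMoment μ X) (hY : EighthMoment μ Y)
    (hX2 : ¬ AEConst μ (fun ω => standardize μ X ω ^ 2))
    (hY2 : ¬ AEConst μ (fun ω => standardize μ Y ω ^ 2)) (h : IndepFun X Y μ) :
    let τ := stdMoment μ X Y 3 0 * stdMoment μ X Y 0 3 /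
      Real.sqrt ((stdMoment μ X Y 4 0 - 1) * (stdMoment μ X Y 0 4 - 1))
    SigmaStar μ X Y = !![1, τ; τ, 1] := by
  intro τ
  have hp := stdMoment_of_indepFun hX hY h
  have h4 := stdMoment_four_zero (Y := Y) hX hX2
  have h4' := stdMoment_zero_four (X := X) hY hY2
  have hq := Real.sqrt_pos.2 (mul_pos h4 h4')
  have hq2 := Real.sq_sqrt (mul_pos h4 h4').le
  have e10 := stdMoment_one_zero (Y := Y) hX
  have e01 := stdMoment_zero_one (X := X) hY
  have e20 := stdMoment_two_zero (Y := Y) hX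
  have e02 := stdMoment_zero_two (X := X) hY
  have h00 : SigmaStar μ X Y 0 0 = 1 := by
    rw [sigmaStar_zero_zero hX hY, rho1_eq, hp 1 1, hp 2 2, e10, e20, e02]
    ring
  have h01 : SigmaStar μ X Y 0 1 = τ := by
    rw [SigmaStar_apply]
    simp only [matM_mulVec_zero, matM_mulVec_one hX hY hX2 hY2, SigmaM_apply hX hY]
    simp only [exponents, Matrix.cons_val, rho1_eq, Nat.reduceAdd]
    simp only [hp 1 1, hp 1 2, hp 2 1, hp 2 2, hp 3 1, hp 1 3, hp 3 3, hp 5 1, hp 1 5, e10, e01,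
      e20, e02, τ]
    ring
  have h11 : SigmaStar μ X Y 1 1 = 1 := by
    rw [SigmaStar_apply]
    simp only [matM_mulVec_one hX hY hX2 hY2, SigmaM_apply hX hY]
    simp only [exponents, Matrix.cons_val, Nat.reduceAdd]
    simp only [hp 1 1, hp 1 2, hp 2 1, hp 2 2, hp 3 2, hp 2 3, hp 4 2, hp 2 4, hp 4 4, e10, e01,
      e20, e02]
    set q := Real.sqrt ((stdMoment μ X Y 4 0 - 1) * (stdMoment μ X Y 0 4 - 1))
    trans (q ^ 2)⁻¹ * ((stdMoment μ X Y 4 0 - 1) * (stdMoment μ X Y 0 4 - 1))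
    · ring
    · rw [hq2, inv_mul_cancel₀ (mul_pos h4 h4').ne']
  ext i j
  fin_cases i <;> fin_cases j
  · exact h00
  · exact h01
  · exact (sigmaStar_comm hX hY).trans h01
  · exact h11

/-- The centre of symmetry must be the mean, and reflection about it reverses the sign of the third
central moment. -/
lemma stdMoment_three_of_isSymmetric (hX : EighthMoment μ X) (h : IsSymmetric μ X) :
    stdMoment μ X Y 3 0 = 0 := by
  obtain ⟨a, ha⟩ := h
  have hint := (memLp_two hX.1 hX.2).integrable (by norm_num)
  have hm : ∫ ω, X ω ∂μ = a := by
    have := ha.integral_eq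
    rw [integral_sub hint (integrable_const _), integral_sub (integrable_const _) hint] at this
    simp at this
    linarith
  have h3 := (ha.comp (u := fun x => (x / Real.sqrt (variance X μ)) ^ 3) (by fun_prop)).integral_eq
  have hneg : ∫ ω, ((a - X ω) / Real.sqrt (variance X μ)) ^ 3 ∂μ =
      -∫ ω, ((X ω - a) / Real.sqrt (variance X μ)) ^ 3 ∂μ := by
    rw [← integral_neg]
    exact integral_congr_ae (ae_of_all _ fun ω => by ring)
  rw [stdMoment_zero_right]
  simp only [standardize, hm]
  simp only [Function.comp_def] at h3
  linarith

end Entries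

/-! ### Moments of centered real Gaussian laws -/

section GaussianMoments

open scoped NNReal

/-- Leibniz rule with a linear factor: only two terms survive, and only the second at `t = 0`. -/
lemma iteratedDeriv_succ_id_mul {g : ℝ → ℝ} (hg : ContDiff ℝ ⊤ g) (n : ℕ) (t : ℝ) :
    iteratedDeriv (n + 1) (fun t => t * g t) t =
      t * iteratedDeriv (n + 1) g t + (n + 1) * iteratedDeriv n g t := by
  have hd : ∀ (n : ℕ) (t : ℝ), HasDerivAt (iteratedDeriv n g) (iteratedDeriv (n + 1) g t) t :=
    fun n t => by
      rw [iteratedDeriv_succ]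
      exact ((hg.differentiable_iteratedDeriv n (by simp)) t).hasDerivAt
  induction n generalizing t with
  | zero =>
    rw [zero_add, iteratedDeriv_one]
    have h := (hasDerivAt_id t).mul (hd 0 t)
    simp only [iteratedDeriv_zero, zero_add, iteratedDeriv_one] at h ⊢
    rw [show (fun t => t * g t) = id * g from rfl, h.deriv]
    simp
    ring
  | succ n ih =>
    rw [iteratedDeriv_succ, funext ih]
    have h := ((hasDerivAt_id t).mul (hd (n + 1) t)).add ((hd n t).const_mul ((n : ℝ) + 1))
    refine (h.deriv).trans ?_
    simp
    ring

lemma integral_pow_gaussianReal_eq (v : ℝ≥0) (n : ℕ) :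
    ∫ x, x ^ n ∂gaussianReal 0 v = iteratedDeriv n (fun t : ℝ => Real.exp (v * t ^ 2 / 2)) 0 := by
  have h := iteratedDeriv_mgf_zero (X := fun x : ℝ => x) (μ := gaussianReal 0 v) (by simp) n
  rw [mgf_fun_id_gaussianReal] at h
  simpa using h.symm

/-- The moment recursion of a centered real Gaussian distribution. -/
lemma integral_pow_add_two_gaussianReal (v : ℝ≥0) (n : ℕ) :
    ∫ x, x ^ (n + 2) ∂gaussianReal 0 v = v * ((n + 1) * ∫ x, x ^ n ∂gaussianReal 0 v) := by
  have hg : ContDiff ℝ ⊤ fun t : ℝ => Real.exp (v * t ^ 2 / 2) := by fun_prop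
  -- The moment generating function `g` satisfies `g' = v t g`; differentiating this `n + 1` times
  -- at 0 is the recursion.
  have hd : deriv (fun t : ℝ => Real.exp (v * t ^ 2 / 2)) =
      fun t => (v : ℝ) * (t * Real.exp (v * t ^ 2 / 2)) := by
    ext t
    have h := ((((hasDerivAt_id t).pow 2).const_mul (v : ℝ)).div_const 2).exp
    refine h.deriv.trans ?_
    simp
    ring
  rw [integral_pow_gaussianReal_eq, integral_pow_gaussianReal_eq, iteratedDeriv_succ', hd,
    iteratedDeriv_const_mul_field, iteratedDeriv_succ_id_mul hg]
  simp

lemma integral_pow_gaussianReal (v : ℝ≥0) :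
    ∫ x, x ^ 0 ∂gaussianReal 0 v = 1 ∧ ∫ x, x ^ 1 ∂gaussianReal 0 v = 0 ∧
    ∫ x, x ^ 2 ∂gaussianReal 0 v = v ∧ ∫ x, x ^ 3 ∂gaussianReal 0 v = 0 ∧
    ∫ x, x ^ 4 ∂gaussianReal 0 v = 3 * v ^ 2 ∧ ∫ x, x ^ 5 ∂gaussianReal 0 v = 0 ∧
    ∫ x, x ^ 6 ∂gaussianReal 0 v = 15 * v ^ 3 ∧ ∫ x, x ^ 7 ∂gaussianReal 0 v = 0 ∧
    ∫ x, x ^ 8 ∂gaussianReal 0 v = 105 * v ^ 4 := by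
  have r := integral_pow_add_two_gaussianReal v
  have r0 : ∫ x, x ^ 0 ∂gaussianReal 0 v = 1 := by simp
  have r1 : ∫ x, x ^ 1 ∂gaussianReal 0 v = 0 := by simp
  have r2 := r 0
  have r3 := r 1
  have r4 := r 2
  have r5 := r 3
  have r6 := r 4
  have r7 := r 5
  have r8 := r 6
  simp only [Nat.reduceAdd, r0, r1] at r2 r3
  simp only [Nat.reduceAdd, r2, r3] at r4 r5
  simp only [Nat.reduceAdd, r4, r5] at r6 r7
  simp only [Nat.reduceAdd, r6] at r8
  rw [r0, r1, r2, r3, r4, r5, r6, r7, r8]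
  push_cast
  refine ⟨rfl, rfl, ?_, ?_, ?_, ?_, ?_, ?_, ?_⟩ <;> ring

end GaussianMoments

/-! ### Entries of the limit covariance: bivariate normal case -/

section GaussianEntries

open scoped NNReal

variable {Ω : Type*} [MeasurableSpace Ω] {μ : Measure Ω} {X Y : Ω → ℝ}

lemma hasGaussianLaw_sub_const {E : Type*} [NormedAddCommGroup E] [NormedSpace ℝ E]
    [MeasurableSpace E] [BorelSpace E] [SecondCountableTopology E] {Z : Ω → E}
    (h : HasGaussianLaw Z μ) (c : E) : HasGaussianLaw (fun ω => Z ω - c) μ := by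
  constructor
  have := h.isGaussian_map
  have hm : μ.map (fun ω => Z ω - c) = (μ.map Z).map (fun z => z - c) :=
    (AEMeasurable.map_map_of_aemeasurable 
      (f := Z) (g := fun z => z - c) (by fun_prop) h.aemeasurable).symm
  rw [hm]
  infer_instance

lemma hasGaussianLaw_standardize (h : HasGaussianLaw (fun ω => (X ω, Y ω)) μ) :
    HasGaussianLaw (fun ω => (standardize μ X ω, standardize μ Y ω)) μ := by
  have := (hasGaussianLaw_sub_const h (∫ ω, X ω ∂μ, ∫ ω, Y ω ∂μ)).map_fun
    (((Real.sqrt (variance X μ))⁻¹ • ContinuousLinearMap.fst ℝ ℝ ℝ).prod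
      ((Real.sqrt (variance Y μ))⁻¹ • ContinuousLinearMap.snd ℝ ℝ ℝ))
  simpa [standardize, div_eq_inv_mul] using! this

lemma integral_pow_of_hasGaussianLaw {Z : Ω → ℝ} (h : HasGaussianLaw Z μ)
    (h0 : ∫ ω, Z ω ∂μ = 0) {v : ℝ} (hv : variance Z μ = v) (k : ℕ) :
    ∫ ω, Z ω ^ k ∂μ = ∫ x, x ^ k ∂gaussianReal 0 v.toNNReal := by
  rw [← hv, ← h0, ← h.map_eq_gaussianReal, integral_map h.aemeasurable (by fun_prop)]

variable [IsProbabilityMeasure μ]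

lemma integrable_pow_of_hasGaussianLaw {Z : Ω → ℝ} (h : HasGaussianLaw Z μ) (k : ℕ) :
    Integrable (fun ω => Z ω ^ k) μ := by
  rcases eq_or_ne k 0 with rfl | hk
  · simp
  · have hi := (h.memLp (p := (k : ENNReal)) (by simp)).integrable_norm_pow hk
    refine hi.mono' (h.aemeasurable.pow_const k).aestronglyMeasurable (ae_of_all _ fun ω => ?_)
    rw [norm_pow]

lemma variance_standardize (hX : EighthMoment μ X) : variance (standardize μ X) μ = 1 := by
  rw [variance_eq_integral (aemeasurable_standardize hX.1), integral_standardize hX]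
  simpa using integral_standardize_sq hX

lemma memLp_standardize (hX : EighthMoment μ X) : MemLp (standardize μ X) 2 μ := by
  rw [memLp_two_iff_integrable_sq (aemeasurable_standardize hX.1).aestronglyMeasurable]
  -- The integral of the square is 1, while a non-integrable function has integral 0.
  by_contra h
  have := integral_standardize_sq hX
  rw [integral_undef h] at this
  exact zero_ne_one this

lemma covariance_standardize (hX : EighthMoment μ X) (hY : EighthMoment μ Y) :
    covariance (standardize μ X) (standardize μ Y) μ = rho1 μ X Y := by
  rw [covariance_eq_sub (memLp_standardize hX) (memLp_standardize hY), integral_standardize hX,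
    rho1_eq]
  simp [stdMoment, stdMonomial]

lemma variance_residual (hX : EighthMoment μ X) (hY : EighthMoment μ Y) :
    variance (fun ω => standardize μ Y ω - rho1 μ X Y * standardize μ X ω) μ =
      1 - rho1 μ X Y ^ 2 := by
  have hU := memLp_standardize hX
  have hV := memLp_standardize hY
  have hc := covariance_standardize hX hY
  have hrU : MemLp (fun ω => rho1 μ X Y * standardize μ X ω) 2 μ := hU.const_mul _
  have hm : AEMeasurable (fun ω => standardize μ Y ω - rho1 μ X Y * standardize μ X ω) μ :=
    (hV.sub hrU).aestronglyMeasurable.aemeasurable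
  rw [← covariance_self hm, covariance_fun_sub_fun_sub hV hrU hV hrU]
  simp only [covariance_const_mul_left, covariance_const_mul_right]
  rw [covariance_self (aemeasurable_standardize hX.1),
    covariance_self (aemeasurable_standardize hY.1),
    variance_standardize hX, variance_standardize hY, covariance_comm (standardize μ Y), hc]
  ring

lemma rho1_sq_le_one (hX : EighthMoment μ X) (hY : EighthMoment μ Y) : rho1 μ X Y ^ 2 ≤ 1 := by
  have h := variance_residual hX hY
  linarith [variance_nonneg (fun ω => standardize μ Y ω - rho1 μ X Y * standardize μ X ω) μ]

/-- The mixed moments of a bivariate normal pair, in terms of those of the real Gaussian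
distribution. -/
lemma stdMoment_of_hasGaussianLaw (hX : EighthMoment μ X) (hY : EighthMoment μ Y)
    (h : HasGaussianLaw (fun ω => (X ω, Y ω)) μ) (k l : ℕ) :
    stdMoment μ X Y k l = ∑ m ∈ Finset.range (l + 1),
      rho1 μ X Y ^ m * l.choose m * ((∫ x, x ^ (k + m) ∂gaussianReal 0 (1 : ℝ).toNNReal) *
        ∫ x, x ^ (l - m) ∂gaussianReal 0 (1 - rho1 μ X Y ^ 2).toNNReal) := by
  have hUV := hasGaussianLaw_standardize h
  set U := standardize μ X with hUdef
  set V := standardize μ Y with hVdef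
  set r := rho1 μ X Y
  -- Regression residual: uncorrelated with `U` and jointly Gaussian with it, hence independent. Its
  -- variance `1 - r ^ 2` may be 0, which covers degenerate pairs.
  let W : Ω → ℝ := fun ω => V ω - r * U ω
  have hUW : HasGaussianLaw (fun ω => (U ω, W ω)) μ := by
    have := hUV.map_fun ((ContinuousLinearMap.fst ℝ ℝ ℝ).prod
      (ContinuousLinearMap.snd ℝ ℝ ℝ - r • ContinuousLinearMap.fst ℝ ℝ ℝ))
    simpa using! this
  have hU2 : MemLp U 2 μ := memLp_standardize hX
  have hV2 : MemLp V 2 μ := memLp_standardize hY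
  have hrU2 : MemLp (fun ω => r * U ω) 2 μ := hU2.const_mul r
  have hcov : covariance U V μ = r := covariance_standardize hX hY
  have hVarU : variance U μ = 1 := variance_standardize hX
  have hcovW : covariance U W μ = 0 := by
    rw [covariance_fun_sub_right hU2 hV2 hrU2, covariance_const_mul_right, hcov,
      covariance_self hUV.fst.aemeasurable, hVarU]
    ring
  have hVarW : variance W μ = 1 - r ^ 2 := variance_residual hX hY
  have hU0 : ∫ ω, U ω ∂μ = 0 := integral_standardize hX
  have hW0 : ∫ ω, W ω ∂μ = 0 := by
    have hV0 : ∫ ω, V ω ∂μ = 0 := integral_standardize hY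
    rw [integral_sub (hV2.integrable (by norm_num)) (hrU2.integrable (by norm_num)),
      integral_const_mul, hU0, hV0]
    simp
  have hind := hUW.indepFun_of_covariance_eq_zero hcovW
  have hpow : ∀ a b : ℕ, IndepFun (fun ω => U ω ^ a) (fun ω => W ω ^ b) μ := fun a b =>
    hind.comp (φ := fun x => x ^ a) (ψ := fun x => x ^ b) (by fun_prop) (by fun_prop)
  have hexp : ∀ ω, stdMonomial μ X Y (k, l) ω =
      ∑ m ∈ Finset.range (l + 1), r ^ m * l.choose m * (U ω ^ (k + m) * W ω ^ (l - m)) := by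
    intro ω
    have hV : V ω = r * U ω + W ω := by simp [W]
    simp only [stdMonomial, ← hUdef, ← hVdef]
    rw [hV, add_pow, Finset.mul_sum]
    exact Finset.sum_congr rfl fun m _ => by ring
  rw [stdMoment, integral_congr_ae (ae_of_all _ hexp), integral_finsetSum]
  · refine Finset.sum_congr rfl fun m _ => ?_
    rw [integral_const_mul, (hpow _ _).integral_fun_mul_eq_mul_integral
      (hUV.fst.aemeasurable.pow_const _).aestronglyMeasurable
      (hUW.snd.aemeasurable.pow_const _).aestronglyMeasurable,
      integral_pow_of_hasGaussianLaw hUV.fst hU0 hVarU,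
      integral_pow_of_hasGaussianLaw hUW.snd hW0 hVarW]
  · intro m _
    exact ((hpow _ _).integrable_mul (integrable_pow_of_hasGaussianLaw hUV.fst _)
      (integrable_pow_of_hasGaussianLaw hUW.snd _)).const_mul _

lemma sigmaStar_of_hasGaussianLaw (hX : EighthMoment μ X) (hY : EighthMoment μ Y)
    (hX2 : ¬ AEConst μ (fun ω => standardize μ X ω ^ 2))
    (hY2 : ¬ AEConst μ (fun ω => standardize μ Y ω ^ 2))
    (h : HasGaussianLaw (fun ω => (X ω, Y ω)) μ) :
    let r := rho1 μ X Y
    SigmaStar μ X Y =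
      !![(1 - r ^ 2) ^ 2, 2 * r * (1 - r ^ 2) ^ 2;
         2 * r * (1 - r ^ 2) ^ 2, (1 - r ^ 2) ^ 2 * (3 * r ^ 4 + 10 * r ^ 2 + 1)] := by
  intro r
  have he := stdMoment_of_hasGaussianLaw hX hY h
  obtain ⟨a0, a1, a2, a3, a4, a5, a6, a7, a8⟩ := integral_pow_gaussianReal (1 : ℝ).toNNReal
  obtain ⟨b0, b1, b2, b3, b4, b5, b6, b7, b8⟩ :=
    integral_pow_gaussianReal (1 - rho1 μ X Y ^ 2).toNNReal
  rw [Real.coe_toNNReal _ zero_le_one] at a2 a4 a6 a8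
  rw [Real.coe_toNNReal _ (sub_nonneg.2 (rho1_sq_le_one hX hY))] at b2 b4 b6 b8
  generalize (1 : ℝ).toNNReal = v at *
  generalize (1 - rho1 μ X Y ^ 2).toNNReal = w at *
  have hr : rho1 μ X Y = r := rfl
  simp only [hr] at he b2 b4 b6 b8
  -- The Gaussian moments become opaque sequences, so that `simp` only substitutes the tabulated
  -- values.
  obtain ⟨A, hA⟩ : ∃ A : ℕ → ℝ, ∀ n, A n = ∫ x, x ^ n ∂gaussianReal 0 v := ⟨_, fun _ => rfl⟩
  obtain ⟨B, hB⟩ : ∃ B : ℕ → ℝ, ∀ n, B n = ∫ x, x ^ n ∂gaussianReal 0 w := ⟨_, fun _ => rfl⟩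
  simp only [← hA, ← hB] at *
  have m30 : stdMoment μ X Y 3 0 = 0 := by
    rw [he]; simp [a3]
  have m03 : stdMoment μ X Y 0 3 = 0 := by
    rw [he]; simp [Finset.sum_range_succ, a0, a1, a2, a3, b0, b1, b2, b3]
  have m12 : stdMoment μ X Y 1 2 = 0 := by
    rw [he]; simp [Finset.sum_range_succ, a1, a2, a3, b0, b1, b2]
  have m21 : stdMoment μ X Y 2 1 = 0 := by
    rw [he]; simp [Finset.sum_range_succ, a2, a3, b0, b1]
  have m40 : stdMoment μ X Y 4 0 = 3 := by
    rw [he]; simp [a4, b0]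
  have m31 : stdMoment μ X Y 3 1 = 3 * r := by
    rw [he]; simp [Finset.sum_range_succ, a3, a4, b0, b1]; ring
  have m22 : stdMoment μ X Y 2 2 = 1 + 2 * r ^ 2 := by
    rw [he]; simp [Finset.sum_range_succ, a2, a3, a4, b0, b1, b2]; ring
  have m13 : stdMoment μ X Y 1 3 = 3 * r := by
    rw [he]; simp [Finset.sum_range_succ, Nat.choose, a1, a2, a3, a4, b0, b1, b2, b3]; ring
  have m04 : stdMoment μ X Y 0 4 = 3 := by
    rw [he]; simp [Finset.sum_range_succ, Nat.choose, a0, a1, a2, a3, a4, b0, b1, b2, b3, b4]; ring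
  have m60 : stdMoment μ X Y 6 0 = 15 := by
    rw [he]; simp [a6, b0]
  have m51 : stdMoment μ X Y 5 1 = 15 * r := by
    rw [he]; simp [Finset.sum_range_succ, a5, a6, b0, b1]; ring
  have m42 : stdMoment μ X Y 4 2 = 3 + 12 * r ^ 2 := by
    rw [he]; simp [Finset.sum_range_succ, a4, a5, a6, b0, b1, b2]; ring
  have m33 : stdMoment μ X Y 3 3 = 9 * r + 6 * r ^ 3 := by
    rw [he]; simp [Finset.sum_range_succ, Nat.choose, a3, a4, a5, a6, b0, b1, b2, b3]; ring
  have m24 : stdMoment μ X Y 2 4 = 3 + 12 * r ^ 2 := by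
    rw [he]; simp [Finset.sum_range_succ, Nat.choose, a2, a3, a4, a5, a6, b0, b1, b2, b3, b4]; ring
  have m15 : stdMoment μ X Y 1 5 = 15 * r := by
    rw [he]
    simp [Finset.sum_range_succ, Nat.choose, a1, a2, a3, a4, a5, a6, b0, b1, b2, b3, b4, b5]
    ring
  have m06 : stdMoment μ X Y 0 6 = 15 := by
    rw [he]
    simp [Finset.sum_range_succ, Nat.choose, a0, a1, a2, a3, a4, a5, a6, b0, b1, b2, b3, b4, b5, b6]
    ring
  have m80 : stdMoment μ X Y 8 0 = 105 := by
    rw [he]; simp [a8, b0]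
  have m62 : stdMoment μ X Y 6 2 = 15 + 90 * r ^ 2 := by
    rw [he]; simp [Finset.sum_range_succ, a6, a7, a8, b0, b1, b2]; ring
  have m44 : stdMoment μ X Y 4 4 = 9 + 72 * r ^ 2 + 24 * r ^ 4 := by
    rw [he]; simp [Finset.sum_range_succ, Nat.choose, a4, a5, a6, a7, a8, b0, b1, b2, b3, b4]; ring
  have m26 : stdMoment μ X Y 2 6 = 15 + 90 * r ^ 2 := by
    rw [he]
    simp [Finset.sum_range_succ, Nat.choose, a2, a3, a4, a5, a6, a7, a8, b0, b1, b2, b3, b4, b5, b6]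
    ring
  have m08 : stdMoment μ X Y 0 8 = 105 := by
    rw [he]
    simp [Finset.sum_range_succ, Nat.choose, a0, a1, a2, a3, a4, a5, a6, a7, a8, b0, b1, b2, b3, b4,
      b5, b6, b7, b8]
    ring
  have e20 := stdMoment_two_zero (Y := Y) hX
  have e02 := stdMoment_zero_two (X := X) hY
  have e11 : stdMoment μ X Y 1 1 = r := rho1_eq.symm
  -- Both fourth moments are 3, so the normalizing root is 2.
  have hq : Real.sqrt ((3 - 1) * (3 - 1)) = 2 := by
    rw [Real.sqrt_mul_self] <;> norm_num
  have h00 : SigmaStar μ X Y 0 0 = (1 - r ^ 2) ^ 2 := by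
    rw [sigmaStar_zero_zero hX hY, hr, m40, m04, m22, m31, m13]
    ring
  have h01 : SigmaStar μ X Y 0 1 = 2 * r * (1 - r ^ 2) ^ 2 := by
    rw [SigmaStar_apply]
    simp only [matM_mulVec_zero, matM_mulVec_one hX hY hX2 hY2, SigmaM_apply hX hY]
    simp only [exponents, Matrix.cons_val, hr, Nat.reduceAdd]
    simp only [m30, m03, m12, m21, m40, m31, m22, m13, m04, m60, m51, m42, m33, m24, m15, m06, e20,
      e02, e11, hq]
    ring
  have h11 : SigmaStar μ X Y 1 1 = (1 - r ^ 2) ^ 2 * (3 * r ^ 4 + 10 * r ^ 2 + 1) := by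
    rw [SigmaStar_apply]
    simp only [matM_mulVec_one hX hY hX2 hY2, SigmaM_apply hX hY]
    simp only [exponents, Matrix.cons_val, Nat.reduceAdd]
    simp only [m30, m03, m12, m21, m40, m22, m04, m60, m42, m24, m06, m80, m62, m44, m26, m08, e20,
      e02, hq]
    ring
  ext i j
  fin_cases i <;> fin_cases j
  · exact h00
  · exact h01
  · exact (sigmaStar_comm hX hY).trans h01
  · exact h11

end GaussianEntries

end MomentCorr

/-! ### The main theorem -/

theorem mainTheorem2 {Ω Ω' : Type*} [MeasurableSpace Ω] [MeasurableSpace Ω']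
    (μ : Measure Ω) [IsProbabilityMeasure μ] (P : Measure Ω') [IsProbabilityMeasure P]
    -- the pair `(X, Y)`
    (X Y : Ω → ℝ) (hX : AEMeasurable X μ) (hY : AEMeasurable Y μ)
    (hX8 : Integrable (fun ω => X ω ^ 8) μ) (hY8 : Integrable (fun ω => Y ω ^ 8) μ)
    (hXc : ¬ AEConst μ X) (hYc : ¬ AEConst μ Y)
    -- the squares have a correlation, i.e. they are not constant
    (hX2 : ¬ AEConst μ (fun ω => standardize μ X ω ^ 2))
    (hY2 : ¬ AEConst μ (fun ω => standardize μ Y ω ^ 2))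
    -- the i.i.d. sample
    (Xs Ys : ℕ → Ω' → ℝ)
    (hindep : iIndepFun (fun i ω => (Xs i ω, Ys i ω)) P)
    (hident : ∀ i, IdentDistrib (fun ω => (Xs i ω, Ys i ω)) (fun ω => (X ω, Y ω)) P μ) :
    -- joint asymptotic normality
    (SigmaStar μ X Y).PosSemidef ∧
    TendstoInDistribution
      (fun (n : ℕ) (ω : Ω') => Real.sqrt n •
        (!₂[rho1Hat n (fun i => Xs i ω) (fun i => Ys i ω),
            rho2Hat n (fun i => Xs i ω) (fun i => Ys i ω)] - !₂[rho1 μ X Y, rho2 μ X Y]))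
      atTop (id : EuclideanSpace ℝ (Fin 2) → EuclideanSpace ℝ (Fin 2))
      (fun _ => P) (multivariateGaussian 0 (SigmaStar μ X Y)) ∧
    -- the first diagonal entry
    SigmaStar μ X Y 0 0 =
      (stdMoment μ X Y 4 0 + stdMoment μ X Y 0 4 + 2 * stdMoment μ X Y 2 2)
          * rho1 μ X Y ^ 2 / 4
        - (stdMoment μ X Y 3 1 + stdMoment μ X Y 1 3) * rho1 μ X Y + stdMoment μ X Y 2 2 ∧
    -- independence
    (IndepFun X Y μ →
      (let τ := stdMoment μ X Y 3 0 * stdMoment μ X Y 0 3 /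
          Real.sqrt ((stdMoment μ X Y 4 0 - 1) * (stdMoment μ X Y 0 4 - 1))
       SigmaStar μ X Y = !![1, τ; τ, 1]) ∧
      (stdMoment μ X Y 3 0 = 0 ∨ stdMoment μ X Y 0 3 = 0 → SigmaStar μ X Y = 1) ∧
      (IsSymmetric μ X ∨ IsSymmetric μ Y → SigmaStar μ X Y = 1)) ∧
    -- bivariate normality
    (HasGaussianLaw (fun ω => (X ω, Y ω)) μ →
      let r := rho1 μ X Y
      SigmaStar μ X Y =
        !![(1 - r ^ 2) ^ 2, 2 * r * (1 - r ^ 2) ^ 2;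
           2 * r * (1 - r ^ 2) ^ 2, (1 - r ^ 2) ^ 2 * (3 * r ^ 4 + 10 * r ^ 2 + 1)]) := by
  have hX' : EighthMoment μ X := ⟨hX, hX8, hXc⟩
  have hY' : EighthMoment μ Y := ⟨hY, hY8, hYc⟩
  refine ⟨sigmaStar_posSemidef hX' hY',
    tendstoInDistribution_correlations hX' hY' hX2 hY2 hindep hident,
    sigmaStar_zero_zero hX' hY', fun h => ?_, sigmaStar_of_hasGaussianLaw hX' hY' hX2 hY2⟩
  have hS := sigmaStar_of_indepFun hX' hY' hX2 hY2 h
  have hone : stdMoment μ X Y 3 0 = 0 ∨ stdMoment μ X Y 0 3 = 0 → SigmaStar μ X Y = 1 := by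
    intro h0
    have hz : stdMoment μ X Y 3 0 * stdMoment μ X Y 0 3 = 0 := mul_eq_zero.2 h0
    rw [hS, hz, zero_div, Matrix.one_fin_two]
  refine ⟨hS, hone, fun hsym => hone (hsym.imp (stdMoment_three_of_isSymmetric hX') fun hs => ?_)⟩
  rw [stdMoment_comm]
  exact stdMoment_three_of_isSymmetric hY' hs
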